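/- Conventions. For a metric space $X$, put $(x|y)_w=\tfrac12\big(d(x,w)+d(y,w)-d(x,y)\big)$. $X$ is *(Gromov) hyperbolic* if there is $\delta\ge 0$ with $(y|z)_w\ge\min\{(x|y)_w,(x|z)_w\}-\delta$ for all $w,x,y,z\in X$. A *geodesic segment* is an isometric embedding of a compact interval, and $X$ is *geodesic* if any two points are joined by a geodesic segment. For $\lambda\ge1$, $c\ge0$, a map $f:X\to Y$ is a *$(\lambda,c)$-quasi-isometric embedding* if $\frac1\lambda d(x,x')-c\le d(f(x),f(x'))\le\lambda d(x,x')+c$ for all $x,x'\in X$; it is a *quasi-isometry* if it is a quasi-isometric embedding for some constants and $Y$ is contained in the $C$-neighbourhood of $f(X)$ for some $C$. A *$(\lambda,c)$-quasigeodesic* is a $(\lambda,c)$-quasi-isometric embedding $g:I\to X$, where $I$ is $\mathbb R$, $\mathbb R_+$ or a compact interval. A *$\tau$-quasiruler* is a quasigeodesic $g:I\to X$ with $(g(s)|g(u))_{g(t)}\le\tau$ for all $s<t<u$ in $I$. $X$ is *quasiruled* if there are $\lambda\ge1$, $c>0$, $\tau>0$ such that any two points of $X$ are joined by a $(\lambda,c)$-quasigeodesic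 segment and every $(\lambda,c)$-quasigeodesic of $X$ is a $\tau$-quasiruler. A quasi-isometric embedding $f:X\to Y$ of a geodesic space is *ruling* if there is $\tau\ge0$ such that the image $f\circ g$ of every geodesic segment $g$ of $X$ is a $\tau$-quasiruler. A subset $A$ of a metric space $Z$ is *quasiconvex* if there is $K$ such that every geodesic segment of $Z$ with endpoints in $A$ lies in the $K$-neighbourhood of $A$. An action of a group $\Gamma$ on a metric space is *properly discontinuous* if for all compact sets $K,L$ only finitely many $\gamma\in\Gamma$ satisfy $\gamma K\cap L\neq\emptyset$; it is *geometric* if it is by isometries, properly discontinuous, and cocompact (the translates of some compact set cover the space). $\Gamma$ is a *quasiconvex group* acting on $Z$ if it acts on $Z$ by isometries, properly discontinuously, and with every orbit quasiconvex in $Z$. Theorem. (1) Let $X$ be a geodesic hyperbolic metric space, $Y$ a metric space and $\varphi:X\to Y$ a quasi-isometry. The following are equivalent: (i) $Y$ is hyperbolic; (ii) $Y$ is quasiruled; (iii) $\varphi$ is ruling. (2) Let $Y$ be a hyperbolic quasiruled metric space. Then there are a geodesic hyperbolic metric space $Z$ and an isometric embedding $\iota:Y\to Z$ such that $\iota(Y)$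 is quasiconvex in $Z$ and, for every group $\Gamma$ acting on $Y$ by isometries, $\Gamma$ admits an action on $Z$ by isometries for which $\iota$ is $\Gamma$-equivariant; if the action of $\Gamma$ on $Y$ is geometric, then this action can moreover be chosen so that $\Gamma$ is a quasiconvex group acting on $Z$. -/

import Mathlib

universe u v w

namespace QuasiRuled

/-- The Gromov product `(x|y)_w`. -/
noncomputable def gromovProduct {X : Type u} [MetricSpace X] (x y w : X) : ℝ :=
  (dist x w + dist y w - dist x y) / 2

/-- Gromov hyperbolicity: `δ`-hyperbolicity for some `δ ≥ 0`. -/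
def IsHyperbolic (X : Type u) [MetricSpace X] : Prop :=
  ∃ δ : ℝ, 0 ≤ δ ∧ ∀ w x y z : X,
    min (gromovProduct x y w) (gromovProduct x z w) - δ ≤ gromovProduct y z w

/-- `g` restricted to the interval `[a, b]` is a geodesic segment (an isometric embedding);
the values of `g` outside `[a, b]` play no role. -/
def IsGeodesicSegment {X : Type u} [MetricSpace X] (a b : ℝ) (g : ℝ → X) : Prop :=
  a ≤ b ∧ ∀ s ∈ Set.Icc a b, ∀ t ∈ Set.Icc a b, dist (g s) (g t) = |s - t|

/-- Every pair of points is joined by a geodesic segment. -/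
def IsGeodesicSpace (X : Type u) [MetricSpace X] : Prop :=
  ∀ x y : X, ∃ (a b : ℝ) (g : ℝ → X), IsGeodesicSegment a b g ∧ g a = x ∧ g b = y

/-- The map `f` is a `(l, c)`-quasi-isometric embedding. -/
def IsQIEmbedding {X : Type u} {Y : Type v} [MetricSpace X] [MetricSpace Y]
    (l c : ℝ) (f : X → Y) : Prop :=
  1 ≤ l ∧ 0 ≤ c ∧ ∀ x x' : X,
    1 / l * dist x x' - c ≤ dist (f x) (f x') ∧ dist (f x) (f x') ≤ l * dist x x' + c

/-- The map `f` is a quasi-isometry: a quasi-isometric embedding such that the target lies in a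
`C`-neighbourhood of the image. -/
def IsQuasiIsometry {X : Type u} {Y : Type v} [MetricSpace X] [MetricSpace Y]
    (f : X → Y) : Prop :=
  (∃ l c : ℝ, IsQIEmbedding l c f) ∧ ∃ C : ℝ, ∀ y : Y, ∃ x : X, dist y (f x) ≤ C

/-- The parameter sets of quasigeodesic curves, rays and segments: the line, the half-line and the
(nonempty) compact intervals. -/
def IsParameterInterval (I : Set ℝ) : Prop :=
  I = Set.univ ∨ I = Set.Ici 0 ∨ ∃ a b : ℝ, a ≤ b ∧ I = Set.Icc a b

/-- `g` restricted to `I` is a `(l, c)`-quasigeodesic (curve, ray or segment), i.e. a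
`(l, c)`-quasi-isometric embedding of `I`. -/
def IsQuasigeodesic {X : Type u} [MetricSpace X] (l c : ℝ) (I : Set ℝ) (g : ℝ → X) : Prop :=
  IsParameterInterval I ∧ IsQIEmbedding l c (fun t : I => g t)

/-- `g` restricted to `I` is a `τ`-quasiruler: a quasigeodesic such that
`(g s | g u)_{g t} ≤ τ` whenever `s < t < u`. -/
def IsQuasiruler {X : Type u} [MetricSpace X] (τ : ℝ) (I : Set ℝ) (g : ℝ → X) : Prop :=
  (∃ l c : ℝ, IsQuasigeodesic l c I g) ∧
    ∀ s ∈ I, ∀ t ∈ I, ∀ u ∈ I, s < t → t < u → gromovProduct (g s) (g u) (g t) ≤ τ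

/-- Every pair of points is joined by a `(l, c)`-quasigeodesic segment. -/
def IsQuasigeodesicSpace (l c : ℝ) (X : Type u) [MetricSpace X] : Prop :=
  ∀ x y : X, ∃ (a b : ℝ) (g : ℝ → X),
    a ≤ b ∧ IsQuasigeodesic l c (Set.Icc a b) g ∧ g a = x ∧ g b = y

/-- For some constants `(l, c, τ)` the space is `(l, c)`-quasigeodesic and every
`(l, c)`-quasigeodesic is a `τ`-quasiruler. -/
def IsQuasiruled (X : Type u) [MetricSpace X] : Prop :=
  ∃ l c τ : ℝ, 1 ≤ l ∧ 0 < c ∧ 0 < τ ∧ IsQuasigeodesicSpace l c X ∧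
    ∀ (I : Set ℝ) (g : ℝ → X), IsQuasigeodesic l c I g → IsQuasiruler τ I g

/-- A quasi-isometric embedding which, for some `τ`, sends every geodesic segment to a
`τ`-quasiruler. -/
def IsRuling {X : Type u} {Y : Type v} [MetricSpace X] [MetricSpace Y] (f : X → Y) : Prop :=
  (∃ l c : ℝ, IsQIEmbedding l c f) ∧
    ∃ τ : ℝ, 0 ≤ τ ∧ ∀ (a b : ℝ) (g : ℝ → X),
      IsGeodesicSegment a b g → IsQuasiruler τ (Set.Icc a b) (fun t => f (g t))

/-- For some `K`, every geodesic segment of the ambient space with endpoints in `A` lies in the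
`K`-neighbourhood of `A`. -/
def IsQuasiconvex {Z : Type u} [MetricSpace Z] (A : Set Z) : Prop :=
  ∃ K : ℝ, ∀ (a b : ℝ) (g : ℝ → Z), IsGeodesicSegment a b g → g a ∈ A → g b ∈ A →
    ∀ t ∈ Set.Icc a b, ∃ z ∈ A, dist (g t) z ≤ K

/-- A geometric action: isometric, properly discontinuous (for compact sets `K`, `L` only finitely
many `γ` satisfy `γ K ∩ L ≠ ∅`) and cocompact. -/
def IsGeometricAction (Γ : Type w) (Y : Type v) [Group Γ] [MetricSpace Y] [MulAction Γ Y] : Prop :=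
  IsIsometricSMul Γ Y ∧ ProperlyDiscontinuousSMul Γ Y ∧
    ∃ K : Set Y, IsCompact K ∧ ∀ y : Y, ∃ γ : Γ, ∃ k ∈ K, γ • k = y

/-- `Γ` acts on `Z` as a quasiconvex group: by isometries, properly discontinuously, and with
quasiconvex orbits. -/
def IsQuasiconvexGroupAction (Γ : Type w) (Z : Type v) [Group Γ] [MetricSpace Z]
    [MulAction Γ Z] : Prop :=
  IsIsometricSMul Γ Z ∧ ProperlyDiscontinuousSMul Γ Z ∧
    ∀ z : Z, IsQuasiconvex (MulAction.orbit Γ z)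

end QuasiRuled

namespace QuasiRuled

open Set Filter Topology
open scoped BoundedContinuousFunction

/-! Part (1) rests on stability of quasigeodesics in a hyperbolic space that may contain no
geodesics. The missing point at parameter `r` between `x` and `y` is replaced by the function `max
(d(x,·) - r) (d(y,·) - (d(x,y) - r))`, which obeys the four-point inequality as a distance to a
point would. A curve staying at height `E` above this virtual point needs length exponential in `E`,
whereas a worst detour of a quasigeodesic has length linear in `E`; this bounds `E`
(`FourPoint.exists_bound`). Hence quasigeodesics of a hyperbolic space are quasirulers. If `Y` is
quasiruled, its quasigeodesics pulled back to `X` pass near the points of geodesics, so geodesics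
map close to quasirulers (`IsQuasiruled.isRuling`). If `φ` is ruling, a point of `X` near two
crossing geodesics keeps bounded Gromov products in `Y`, and the triangle inequality gives the
four-point condition (`IsRuling.isHyperbolic`).

For part (2), the injective hull is geodesic, inherits isometric actions, and lies in a bounded
neighbourhood of `Y`. The action on it can fail to be properly discontinuous: an infinite group with
all nonzero distances equal to 1 acts geometrically on itself, but fixes the constant function 1/2
in the hull. So `Z` is the max-metric product of the hull with a bounded geodesic space, `BumpHull
Y`, on which proper discontinuity survives. As `Z` is within bounded distance of `Y`, hyperbolicity
and quasiconvexity follow. -/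

/-! ### The four-point condition and virtual points of geodesics. -/

/-- The four-point form of `δ`-hyperbolicity. -/
def FourPoint (δ : ℝ) (Y : Type u) [MetricSpace Y] : Prop :=
  ∀ a b c d : Y,
    dist a b + dist c d ≤ max (dist a c + dist b d) (dist a d + dist b c) + 2 * δ

theorem isHyperbolic_iff_fourPoint {Y : Type u} [MetricSpace Y] :
    IsHyperbolic Y ↔ ∃ δ : ℝ, 0 < δ ∧ FourPoint δ Y := by
  constructor
  · rintro ⟨δ, hδ, h⟩
    refine ⟨δ + 1, by linarith, fun a b c d => ?_⟩
    have := h d c a b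
    simp only [gromovProduct] at this
    rw [dist_comm c a, dist_comm c b] at this
    rcases le_total (dist a c + dist b d) (dist a d + dist b c) with h1 | h1
    · rw [max_eq_right h1]
      rcases min_le_iff.1 (sub_le_iff_le_add.1 this) with h2 | h2 <;> linarith
    · rw [max_eq_left h1]
      rcases min_le_iff.1 (sub_le_iff_le_add.1 this) with h2 | h2 <;> linarith
  · rintro ⟨δ, hδ, h⟩
    refine ⟨δ, hδ.le, fun w x y z => ?_⟩
    have := h y z x w
    simp only [gromovProduct]
    rw [dist_comm y x, dist_comm z x] at this
    rw [sub_le_iff_le_add, min_le_iff]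
    rcases le_total (dist x y + dist z w) (dist y w + dist x z) with h1 | h1
    · rw [max_eq_right h1] at this
      right; linarith
    · rw [max_eq_left h1] at this
      left; linarith

/-- A function on `Y` that behaves as the distance to a further point of a `δ`-hyperbolic space
containing `Y`. -/
def IsBasedFunction {Y : Type u} [MetricSpace Y] (δ : ℝ) (F : Y → ℝ) : Prop :=
  ∀ a b c : Y, F c + dist a b ≤ max (F a + dist b c) (F b + dist a c) + 2 * δ

/-- The four-point condition says this for a single distance function; the property survives
subtracting a constant and taking a maximum. -/
theorem FourPoint.isBasedFunction {Y : Type u} [MetricSpace Y] {δ : ℝ} (h : FourPoint δ Y)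
    (x y : Y) (r s : ℝ) :
    IsBasedFunction δ (fun z => max (dist x z - r) (dist y z - s)) := by
  intro a b c
  have h1 := h a b c x
  have h2 := h a b c y
  simp only [dist_comm a x, dist_comm b x, dist_comm c x, dist_comm a y, dist_comm b y,
    dist_comm c y] at h1 h2
  grind

/-- Along a path that stays at height `D`, the Gromov product of the endpoints decreases at most
logarithmically in the length. -/
theorem IsBasedFunction.le_of_forall_le {Y : Type u} [MetricSpace Y] {δ l c D : ℝ} {F : Y → ℝ}
    (hF : IsBasedFunction δ F) (hl : 0 ≤ l) {g : ℝ → Y} (k : ℕ) {s t : ℝ} (hst : s ≤ t)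
    (hk : t - s ≤ 2 ^ k) (hD : ∀ r ∈ Icc s t, D ≤ F (g r))
    (hg : ∀ r ∈ Icc s t, ∀ r' ∈ Icc s t, dist (g r) (g r') ≤ l * |r - r'| + c) :
    2 * D - (l + c) - 2 * k * δ ≤ F (g s) + F (g t) - dist (g s) (g t) := by
  induction k generalizing s t with
  | zero =>
    have h1 := hD s ⟨le_rfl, hst⟩
    have h2 := hD t ⟨hst, le_rfl⟩
    have h3 := hg s ⟨le_rfl, hst⟩ t ⟨hst, le_rfl⟩
    have h4 : l * |s - t| ≤ l * 1 := by
      gcongr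
      rw [abs_sub_comm, abs_of_nonneg (by linarith)]
      simpa using hk
    simp only [CharP.cast_eq_zero]
    linarith
  | succ k ih =>
    rw [pow_succ] at hk
    have hm : (s + t) / 2 ∈ Icc s t := ⟨by linarith, by linarith⟩
    have h1 := ih (s := s) (t := (s + t) / 2) hm.1 (by linarith)
      (fun r hr => hD r ⟨hr.1, hr.2.trans hm.2⟩)
      (fun r hr r' hr' => hg r ⟨hr.1, hr.2.trans hm.2⟩ r' ⟨hr'.1, hr'.2.trans hm.2⟩)
    have h2 := ih (s := (s + t) / 2) (t := t) hm.2 (by linarith)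
      (fun r hr => hD r ⟨hm.1.trans hr.1, hr.2⟩)
      (fun r hr r' hr' => hg r ⟨hm.1.trans hr.1, hr.2⟩ r' ⟨hm.1.trans hr'.1, hr'.2⟩)
    -- With `F` read as distance to a base point, this is the hyperbolic inequality for doubled
    -- Gromov products there, so each halving of the interval costs `2 * δ`.
    have h3 := hF (g s) (g t) (g ((s + t) / 2))
    rw [dist_comm (g t) (g ((s + t) / 2))] at h3
    push_cast
    grind

/-! ### Stability of quasigeodesics. -/

theorem IsQuasigeodesic.dist_le {Y : Type u} [MetricSpace Y] {l c : ℝ} {I : Set ℝ} {g : ℝ → Y}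
    (h : IsQuasigeodesic l c I g) {s t : ℝ} (hs : s ∈ I) (ht : t ∈ I) :
    dist (g s) (g t) ≤ l * |s - t| + c :=
  (h.2.2.2 ⟨s, hs⟩ ⟨t, ht⟩).2

theorem IsQuasigeodesic.abs_sub_le {Y : Type u} [MetricSpace Y] {l c : ℝ} {I : Set ℝ} {g : ℝ → Y}
    (h : IsQuasigeodesic l c I g) {s t : ℝ} (hs : s ∈ I) (ht : t ∈ I) :
    |s - t| ≤ l * (dist (g s) (g t) + c) := by
  have h1 := (h.2.2.2 ⟨s, hs⟩ ⟨t, ht⟩).1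
  have hl : 0 < l := by linarith [h.2.1]
  rw [Subtype.dist_eq, Real.dist_eq, sub_le_iff_le_add, one_div, inv_mul_le_iff₀ hl] at h1
  exact h1

theorem IsQuasigeodesic.mono {Y : Type u} [MetricSpace Y] {l c : ℝ} {I : Set ℝ} {g : ℝ → Y}
    (h : IsQuasigeodesic l c I g) {s t : ℝ} (hst : s ≤ t) (hI : Icc s t ⊆ I) :
    IsQuasigeodesic l c (Icc s t) g :=
  ⟨.inr (.inr ⟨s, t, hst, rfl⟩), h.2.1, h.2.2.1, fun x x' =>
    h.2.2.2 ⟨x, hI x.2⟩ ⟨x', hI x'.2⟩⟩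

theorem IsParameterInterval.Icc_subset {I : Set ℝ} (h : IsParameterInterval I) {s t : ℝ}
    (hs : s ∈ I) (ht : t ∈ I) : Icc s t ⊆ I := by
  rcases h with rfl | rfl | ⟨a, b, -, rfl⟩
  · exact subset_univ _
  · exact fun x hx => le_trans hs hx.1
  · exact Icc_subset_Icc hs.1 ht.2

/-- A quantity bounded by the logarithm of a linear function of itself is bounded. For the least `N`
with `E ≤ a + (N + 1) * δ`, a large `N` would make `2 ^ N` exceed `l * E + m`, so that `E ≤ a + N *
δ`, against minimality. -/
theorem exists_bound_of_le_log {δ l m a : ℝ} (hδ : 0 < δ) :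
    ∃ E₀ : ℝ, ∀ E : ℝ, (∀ k : ℕ, l * E + m ≤ 2 ^ k → E ≤ a + k * δ) → 0 ≤ l → E ≤ E₀ := by
  have ht : Filter.Tendsto (fun k : ℕ => ((l * δ) * (k : ℝ) + (l * (a + δ) + m)) / 2 ^ k)
      Filter.atTop (nhds 0) := by
    have h1 := (tendsto_pow_const_div_const_pow_of_one_lt 1 (one_lt_two (α := ℝ))).const_mul (l * δ)
    have h2 := (tendsto_inv_atTop_zero.comp
      (tendsto_pow_atTop_atTop_of_one_lt (one_lt_two (α := ℝ)))).const_mul (l * (a + δ) + m)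
    convert h1.add h2 using 1
    · ext k
      simp only [Function.comp, pow_one]
      ring
    · simp
  obtain ⟨k₀, hk₀⟩ := Filter.eventually_atTop.1 (ht.eventually (gt_mem_nhds zero_lt_one))
  refine ⟨a + (k₀ + 1) * δ, fun E hE hl => ?_⟩
  by_contra! hlt
  have hex : ∃ n : ℕ, E ≤ a + (n + 1) * δ := by
    obtain ⟨n, hn⟩ := exists_nat_ge ((E - a) / δ)
    rw [div_le_iff₀ hδ] at hn
    exact ⟨n, by linarith⟩
  classical
  have hfind := Nat.find_spec hex
  set N := Nat.find hex with hN
  have hN0 : k₀ < N := by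
    by_contra! h
    have : (N : ℝ) ≤ k₀ := by exact_mod_cast h
    nlinarith
  have hkN := hk₀ N hN0.le
  rw [div_lt_one (by positivity)] at hkN
  have h1 := hE N (by nlinarith [mul_le_mul_of_nonneg_left hfind hl])
  have h2 := Nat.find_min hex (m := N - 1) (by omega)
  apply h2
  have : ((N - 1 : ℕ) : ℝ) = N - 1 := by
    rw [Nat.cast_sub (by omega)]; simp
  rw [this]
  linarith

/-- Both `p` and `q` are near the virtual point at parameter `r` between `x` and `y`, and such a
point is coarsely unique. -/
theorem FourPoint.dist_le_add {Y : Type u} [MetricSpace Y] {δ : ℝ} (h : FourPoint δ Y)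
    {x y p q : Y} {r A B : ℝ} (h1 : dist x p ≤ r + A) (h2 : dist y p ≤ dist x y - r + A)
    (h3 : dist x q ≤ r + B) (h4 : dist y q ≤ dist x y - r + B) :
    dist p q ≤ A + B + 2 * δ := by
  have := h x y p q
  grind

/-- A quasigeodesic of a hyperbolic space passes near every (possibly virtual) point of a geodesic
with the same endpoints. -/
theorem FourPoint.exists_bound {Y : Type u} [MetricSpace Y] {δ : ℝ} (hδ : 0 < δ)
    (h : FourPoint δ Y) (l c : ℝ) :
    ∃ D : ℝ, 0 ≤ D ∧ ∀ (a b : ℝ) (g : ℝ → Y), a ≤ b → IsQuasigeodesic l c (Icc a b) g →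
      ∀ r ∈ Icc 0 (dist (g a) (g b)), ∃ t ∈ Icc a b,
        dist (g a) (g t) ≤ r + D ∧ dist (g b) (g t) ≤ dist (g a) (g b) - r + D := by
  obtain ⟨E₀, hE₀⟩ := exists_bound_of_le_log (l := 4 * l) (m := l * (4 * δ + 2 + c))
    (a := 2 + (l + c) / 2 + δ) hδ
  refine ⟨max E₀ 0, le_max_right _ _, fun a b g hab hg r₀ hr₀ => ?_⟩
  set x := g a with hx
  set y := g b with hy
  set d := dist x y with hd
  have hl : 1 ≤ l := hg.2.1
  have hc : 0 ≤ c := hg.2.2.1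
  let f : ℝ → Y → ℝ := fun r z => max (dist x z - r) (dist y z - (d - r))
  -- The heights at which the whole curve misses some virtual point; `sSup S` is the worst
  -- deviation, and `r` below nearly realises it.
  let S : Set ℝ := {D | ∃ r ∈ Icc 0 d, ∀ t ∈ Icc a b, D ≤ f r (g t)}
  have hS0 : (0 : ℝ) ∈ S := by
    refine ⟨0, ⟨le_rfl, dist_nonneg⟩, fun t _ => le_max_of_le_left ?_⟩
    simp
  have hSb : BddAbove S := by
    refine ⟨d, ?_⟩
    rintro D ⟨r, hr, hD⟩
    refine (hD a ⟨le_rfl, hab⟩).trans (max_le ?_ ?_)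
    · simp only [← hx, dist_self]
      linarith [hr.1, hr.2]
    · rw [dist_comm, ← hx, ← hd]
      linarith [hr.2]
  obtain ⟨D', ⟨r, hr, hD'⟩, hlt⟩ := exists_lt_of_lt_csSup ⟨0, hS0⟩ (sub_one_lt (sSup S))
  set E := sSup S + 1 with hE
  have hE1 : 1 ≤ E := by linarith [le_csSup hSb hS0]
  have hnear : ∀ r' ∈ Icc 0 d, ∃ t ∈ Icc a b, dist x (g t) ≤ r' + E ∧
      dist y (g t) ≤ d - r' + E := by
    intro r' hr'
    by_contra! hcon
    have : E ∈ S := by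
      refine ⟨r', hr', fun t ht => ?_⟩
      by_contra! hlt
      rw [max_lt_iff] at hlt
      linarith [hcon t ht (by linarith)]
    linarith [le_csSup hSb this]
  -- Curve points near the virtual points at parameters `E + δ + 1` before and after `r`, or an
  -- endpoint if there is no room. The offset exceeds `E`, which decides the term realising the
  -- maximum in `f r`; the surplus `δ + 1` excludes the wrong pairing in the four-point inequality
  -- for `hij`.
  obtain ⟨i, hi, hi1, hi2, hi3⟩ : ∃ i ∈ Icc a b,
      f r (g i) = dist y (g i) - (d - r) ∧ f r (g i) ≤ 2 * E + δ + 1 ∧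
        (g i = x ∨ dist x (g i) ≤ r - δ - 1) := by
    rcases le_total 0 (r - (E + δ + 1)) with h0 | h0
    · obtain ⟨i, hi, h1, h2⟩ := hnear (r - (E + δ + 1)) ⟨h0, by linarith [hr.2]⟩
      have h3 := dist_triangle_right x y (g i)
      refine ⟨i, hi, max_eq_right (by linarith), max_le (by linarith) (by linarith), .inr ?_⟩
      linarith
    · refine ⟨a, ⟨le_rfl, hab⟩, max_eq_right ?_, max_le ?_ ?_, .inl rfl⟩
      · rw [← hx, dist_self, dist_comm]
        linarith [hr.1]
      · rw [← hx, dist_self]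
        linarith [hr.1]
      · rw [← hx, dist_comm]
        linarith
  obtain ⟨j, hj, hj1, hj2, hj3⟩ : ∃ j ∈ Icc a b,
      f r (g j) = dist x (g j) - r ∧ f r (g j) ≤ 2 * E + δ + 1 ∧
        (g j = y ∨ dist y (g j) ≤ d - r - δ - 1) := by
    rcases le_total (r + (E + δ + 1)) d with h0 | h0
    · obtain ⟨i, hi, h1, h2⟩ := hnear (r + (E + δ + 1)) ⟨by linarith [hr.1], h0⟩
      have h3 := dist_triangle_right x y (g i)
      refine ⟨i, hi, max_eq_left (by linarith), max_le (by linarith) (by linarith), .inr ?_⟩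
      linarith
    · refine ⟨b, ⟨hab, le_rfl⟩, max_eq_left ?_, max_le ?_ ?_, .inl rfl⟩
      · rw [← hy, dist_self]
        linarith [hr.2]
      · rw [← hy]
        linarith [hr.1]
      · rw [← hy, dist_self]
        linarith [hr.2]
  have hij : dist x (g j) + dist y (g i) - d - 2 * δ ≤ dist (g i) (g j) := by
    rcases hi3 with hi3 | hi3
    · rw [hi3, dist_comm y x]
      linarith
    · rcases hj3 with hj3 | hj3
      · rw [hj3, dist_comm (g i) y]
        linarith
      · have h1 := h x (g j) y (g i)
        have h3 := dist_triangle_right x y (g i)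
        have h4 := dist_triangle_right x y (g j)
        rw [dist_comm (g j) (g i), dist_comm (g j) y] at h1
        grind
  have hprod : f r (g i) + f r (g j) - dist (g i) (g j) ≤ 2 * δ := by
    rw [hi1, hj1]
    linarith
  have hdist : dist (g i) (g j) ≤ 4 * E + 4 * δ + 2 := by
    have h1 := h.dist_le_add (x := x) (y := y) (p := g i) (q := g j) (r := r)
      (A := 2 * E + δ + 1) (B := 2 * E + δ + 1)
      (by linarith [(le_max_left _ _ : _ ≤ f r (g i))])
      (by linarith [(le_max_right _ _ : _ ≤ f r (g i))])
      (by linarith [(le_max_left _ _ : _ ≤ f r (g j))])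
      (by linarith [(le_max_right _ _ : _ ≤ f r (g j))])
    linarith
  have hlen := hg.abs_sub_le hi hj
  -- Between `i` and `j` the curve has parameter length linear in `E` and height at least `E - 2`,
  -- while the doubled product of its endpoints is at most `2 * δ`: the logarithmic bound applies.
  have hbd : E ≤ E₀ := by
    refine hE₀ E (fun k hk => ?_) (by linarith)
    have hlen2 : |i - j| ≤ 2 ^ k := by
      refine (hlen.trans ?_).trans hk
      nlinarith
    have hbased := h.isBasedFunction x y r (d - r)
    rcases le_total i j with h0 | h0
    · have h1 := hbased.le_of_forall_le (l := l) (c := c) (D := E - 2) (g := g) (by linarith) k h0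
        (by rwa [abs_sub_comm, abs_of_nonneg (by linarith)] at hlen2)
        (fun t ht => by linarith [hD' t ⟨hi.1.trans ht.1, ht.2.trans hj.2⟩])
        (fun t ht t' ht' => hg.dist_le ⟨hi.1.trans ht.1, ht.2.trans hj.2⟩
          ⟨hi.1.trans ht'.1, ht'.2.trans hj.2⟩)
      have h2 := h1.trans hprod
      linarith
    · have h1 := hbased.le_of_forall_le (l := l) (c := c) (D := E - 2) (g := g) (by linarith) k h0
        (by rwa [abs_of_nonneg (by linarith)] at hlen2)
        (fun t ht => by linarith [hD' t ⟨hj.1.trans ht.1, ht.2.trans hi.2⟩])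
        (fun t ht t' ht' => hg.dist_le ⟨hj.1.trans ht.1, ht.2.trans hi.2⟩
          ⟨hj.1.trans ht'.1, ht'.2.trans hi.2⟩)
      rw [dist_comm (g j) (g i), add_comm (max _ _)] at h1
      have h2 := h1.trans hprod
      linarith
  obtain ⟨t, ht, h1, h2⟩ := hnear r₀ hr₀
  exact ⟨t, ht, h1.trans (by linarith [le_max_left E₀ 0]), h2.trans (by linarith [le_max_left E₀ 0])⟩

/-- Quasigeodesics of a hyperbolic space are quasirulers, with uniform constants. -/
theorem FourPoint.exists_gromovProduct_le {Y : Type u} [MetricSpace Y] {δ : ℝ} (hδ : 0 < δ)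
    (h : FourPoint δ Y) (l c : ℝ) :
    ∃ T : ℝ, 0 ≤ T ∧ ∀ (a b : ℝ) (g : ℝ → Y), IsQuasigeodesic l c (Icc a b) g →
      ∀ t ∈ Icc a b, gromovProduct (g a) (g b) (g t) ≤ T := by
  obtain ⟨D, hD0, hD⟩ := h.exists_bound hδ l c
  refine ⟨max (D + 1 + l * (l * (2 * D + 1 + 2 * δ + c)) + c) 0, le_max_right _ _,
    fun a b g hg t ht => le_max_of_le_left ?_⟩
  have hl : 1 ≤ l := hg.2.1
  have hab : a ≤ b := ht.1.trans ht.2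
  set x := g a with hx
  set y := g b with hy
  set d := dist x y with hd
  -- The virtual points approached before time `t`. Just below `sSup L` there is an approach at `i ≤
  -- t`, and one unit further on an approach at `j ≥ t`; `g i` and `g j` are close, so `|i - j|` is
  -- bounded and `g t` is close to `g i`.
  let L : Set ℝ := {r | r ∈ Icc 0 d ∧ ∃ i ∈ Icc a t, dist x (g i) ≤ r + D ∧
    dist y (g i) ≤ d - r + D}
  have hL0 : (0 : ℝ) ∈ L := by
    refine ⟨⟨le_rfl, dist_nonneg⟩, a, ⟨le_rfl, ht.1⟩, ?_, ?_⟩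
    · rw [← hx, dist_self]; linarith
    · rw [← hx, dist_comm]; linarith
  have hLb : BddAbove L := ⟨d, fun r hr => hr.1.2⟩
  obtain ⟨r, ⟨hr, i, hi, hi1, hi2⟩, hlt⟩ :=
    exists_lt_of_lt_csSup ⟨0, hL0⟩ (sub_one_lt (sSup L))
  obtain ⟨j, hj, hj1, hj2⟩ : ∃ j ∈ Icc t b, dist x (g j) ≤ r + (D + 1) ∧
      dist y (g j) ≤ d - r + (D + 1) := by
    rcases le_total (r + 1) d with h1 | h1
    · obtain ⟨j, hj, hj1, hj2⟩ := hD a b g hab hg (r + 1) ⟨by linarith [hr.1], h1⟩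
      rcases le_total j t with h2 | h2
      · have : r + 1 ∈ L := ⟨⟨by linarith [hr.1], h1⟩, j, ⟨hj.1, h2⟩, hj1, hj2⟩
        linarith [le_csSup hLb this]
      · exact ⟨j, ⟨h2, hj.2⟩, by linarith, by linarith⟩
    · refine ⟨b, ⟨ht.2, le_rfl⟩, by linarith, ?_⟩
      rw [← hy, dist_self]
      linarith [hr.2]
  have hij := h.dist_le_add hi1 hi2 hj1 hj2
  have hi' : i ∈ Icc a b := ⟨hi.1, hi.2.trans ht.2⟩
  have hj' : j ∈ Icc a b := ⟨ht.1.trans hj.1, hj.2⟩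
  have h3 := hg.abs_sub_le hi' hj'
  have h4 := hg.dist_le hi' ht
  have h5 : |i - t| ≤ l * (2 * D + 1 + 2 * δ + c) := by
    have h6 : |i - t| ≤ |i - j| := by
      rw [abs_sub_comm, abs_sub_comm i j, abs_of_nonneg (by linarith [hi.2]),
        abs_of_nonneg (by linarith [hi.2, hj.1])]
      linarith [hj.1]
    refine (h6.trans h3).trans ?_
    gcongr
    linarith
  have h6 : l * |i - t| ≤ l * (l * (2 * D + 1 + 2 * δ + c)) := by gcongr
  have h7 := dist_triangle x (g i) (g t)
  have h8 := dist_triangle y (g i) (g t)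
  simp only [gromovProduct]
  linarith

/-! ### Quasi-isometries, coarse inverses and transported quasigeodesics. -/

theorem gromovProduct_le_add {X : Type u} [MetricSpace X] (x x' y y' w w' : X) :
    gromovProduct x y w ≤
      gromovProduct x' y' w' + dist x x' + dist y y' + dist w w' := by
  have h1 := dist_triangle4 x x' w' w
  have h2 := dist_triangle4 y y' w' w
  have h3 := dist_triangle4 x' x y y'
  rw [dist_comm w' w] at h1 h2
  rw [dist_comm x' x] at h3
  simp only [gromovProduct]
  linarith

theorem IsQIEmbedding.dist_le {X : Type u} {Y : Type v} [MetricSpace X] [MetricSpace Y]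
    {l c : ℝ} {f : X → Y} (h : IsQIEmbedding l c f) (x x' : X) :
    dist (f x) (f x') ≤ l * dist x x' + c :=
  (h.2.2 x x').2

theorem IsQIEmbedding.le_dist {X : Type u} {Y : Type v} [MetricSpace X] [MetricSpace Y]
    {l c : ℝ} {f : X → Y} (h : IsQIEmbedding l c f) (x x' : X) :
    dist x x' ≤ l * (dist (f x) (f x') + c) := by
  have h1 := (h.2.2 x x').1
  have hl : 0 < l := by linarith [h.1]
  rwa [sub_le_iff_le_add, one_div, inv_mul_le_iff₀ hl] at h1

theorem isQIEmbedding_of_le {X : Type u} {Y : Type v} [MetricSpace X] [MetricSpace Y]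
    {l c : ℝ} {f : X → Y} (hl : 1 ≤ l) (hc : 0 ≤ c)
    (h1 : ∀ x x', dist (f x) (f x') ≤ l * dist x x' + c)
    (h2 : ∀ x x', dist x x' ≤ l * (dist (f x) (f x') + c)) : IsQIEmbedding l c f := by
  refine ⟨hl, hc, fun x x' => ⟨?_, h1 x x'⟩⟩
  rw [sub_le_iff_le_add, one_div, inv_mul_le_iff₀ (by linarith)]
  exact h2 x x'

theorem IsQIEmbedding.comp {X : Type u} {Y : Type v} {W : Type w} [MetricSpace X] [MetricSpace Y]
    [MetricSpace W] {l c l' c' : ℝ} {f : X → Y} {f' : Y → W} (h' : IsQIEmbedding l' c' f')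
    (h : IsQIEmbedding l c f) : IsQIEmbedding (l' * l) (l' * c + c') (f' ∘ f) := by
  have hl := h.1
  have hc := h.2.1
  have hl' := h'.1
  have hc' := h'.2.1
  refine isQIEmbedding_of_le (by nlinarith) (by positivity) (fun x x' => ?_) (fun x x' => ?_)
  · have h1 := h'.dist_le (f x) (f x')
    have h2 := mul_le_mul_of_nonneg_left (h.dist_le x x') (show 0 ≤ l' by linarith)
    simp only [Function.comp]
    linarith
  · have h1 := h.le_dist x x'
    have h2 := h'.le_dist (f x) (f x')
    have h3 := mul_le_mul_of_nonneg_left h2 (show 0 ≤ l by linarith)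
    have h4 : l * c ≤ l * (l' * (l' * c)) := by
      gcongr
      nlinarith [mul_le_mul hl' hl' zero_le_one (by linarith)]
    simp only [Function.comp]
    nlinarith

theorem IsQuasigeodesic.comp {X : Type u} {Y : Type v} [MetricSpace X] [MetricSpace Y]
    {l c l' c' : ℝ} {I : Set ℝ} {g : ℝ → X} {f : X → Y} (hf : IsQIEmbedding l' c' f)
    (hg : IsQuasigeodesic l c I g) : IsQuasigeodesic (l' * l) (l' * c + c') I (fun t => f (g t)) :=
  ⟨hg.1, hf.comp hg.2⟩

theorem IsGeodesicSegment.isQuasigeodesic {X : Type u} [MetricSpace X] {a b : ℝ} {g : ℝ → X}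
    (h : IsGeodesicSegment a b g) : IsQuasigeodesic 1 0 (Icc a b) g := by
  refine ⟨.inr (.inr ⟨a, b, h.1, rfl⟩), le_rfl, le_rfl, fun x x' => ?_⟩
  rw [h.2 x x.2 x' x'.2, Subtype.dist_eq, Real.dist_eq]
  simp

theorem IsQuasiIsometry.exists_inverse {X : Type u} {Y : Type v} [MetricSpace X] [MetricSpace Y]
    {f : X → Y} (h : IsQuasiIsometry f) :
    ∃ (C l c : ℝ) (ψ : Y → X), 0 ≤ C ∧ IsQIEmbedding l c f ∧ (∀ y, dist y (f (ψ y)) ≤ C) ∧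
      IsQIEmbedding l (l * (2 * C + c)) ψ := by
  obtain ⟨⟨l, c, hf⟩, C, hC⟩ := h
  choose ψ hψ using hC
  have hl := hf.1
  have hc := hf.2.1
  have hψ' : ∀ y, dist y (f (ψ y)) ≤ max C 0 := fun y => (hψ y).trans (le_max_left _ _)
  have hC0 := le_max_right C 0
  generalize max C 0 = C' at hψ' hC0
  refine ⟨C', l, c, ψ, hC0, hf, hψ', isQIEmbedding_of_le hl (by positivity)
    (fun y y' => ?_) (fun y y' => ?_)⟩
  · have h1 := hf.le_dist (ψ y) (ψ y')
    have h2 := dist_triangle4 (f (ψ y)) y y' (f (ψ y'))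
    rw [dist_comm (f (ψ y)) y] at h2
    have h3 : dist (f (ψ y)) (f (ψ y')) + c ≤ dist y y' + (2 * C' + c) := by
      linarith [hψ' y, hψ' y']
    calc _ ≤ _ := h1
      _ ≤ l * (dist y y' + (2 * C' + c)) := by gcongr
      _ = _ := by ring
  · have h1 := hf.dist_le (ψ y) (ψ y')
    have h2 := dist_triangle4 y (f (ψ y)) (f (ψ y')) y'
    rw [dist_comm (f (ψ y')) y'] at h2
    have h3 : 2 * C' + c ≤ l * (l * (2 * C' + c)) := by
      have : 0 ≤ 2 * C' + c := by positivity
      nlinarith [mul_le_mul hl hl zero_le_one (by linarith)]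
    linarith [hψ' y, hψ' y']

/-- A space quasi-isometric to a geodesic space is quasigeodesic. -/
theorem IsQuasiIsometry.exists_isQuasigeodesicSpace {X : Type u} {Y : Type v} [MetricSpace X]
    [MetricSpace Y] {f : X → Y} (h : IsQuasiIsometry f) (hX : IsGeodesicSpace X) :
    ∃ l c : ℝ, 1 ≤ l ∧ 0 < c ∧ IsQuasigeodesicSpace l c Y := by
  obtain ⟨C, l, c, ψ, hC, hf, hψ, -⟩ := h.exists_inverse
  have hl := hf.1
  have hc := hf.2.1
  refine ⟨l, 2 * l + c + 2 * C + 1, hl, by positivity, fun y y' => ?_⟩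
  obtain ⟨a, b, g, hg, hga, hgb⟩ := hX (ψ y) (ψ y')
  have hab := hg.1
  -- The interval is lengthened by one because `ψ y = ψ y'` is possible with `y ≠ y'`; the endpoint
  -- values can then be corrected separately.
  have hab' : a ≠ b + 1 := by linarith
  let p : ℝ → ℝ := fun t => min t b
  have hp : ∀ s t, |p s - p t| ≤ |s - t| := fun s t => by
    simpa using abs_min_sub_min_le_max s b t b
  have hp' : ∀ s ∈ Icc a (b + 1), ∀ t ∈ Icc a (b + 1), |s - t| ≤ |p s - p t| + 1 := by
    intro s hs t ht
    have h1 := hs.2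
    have h2 := ht.2
    simp only [p]
    grind
  have hpm : ∀ s ∈ Icc a (b + 1), p s ∈ Icc a b := fun s hs =>
    ⟨le_min hs.1 hab, min_le_right _ _⟩
  let k : ℝ → Y := fun t => if t = a then y else if t = b + 1 then y' else f (g (p t))
  have hk : ∀ t, dist (k t) (f (g (p t))) ≤ C := by
    intro t
    simp only [k]
    split_ifs with h1 h2
    · rw [h1, show p a = a from min_eq_left hab, hga]
      exact hψ y
    · rw [h2, show p (b + 1) = b from min_eq_right (by linarith), hgb]
      exact hψ y'
    · rwa [dist_self]
  refine ⟨a, b + 1, k, by linarith, ⟨.inr (.inr ⟨a, b + 1, by linarith, rfl⟩), ?_⟩, by simp [k],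
    by simp [k, hab'.symm]⟩
  refine isQIEmbedding_of_le hl (by positivity) (fun s t => ?_) (fun s t => ?_)
  · have h1 := hf.dist_le (g (p s)) (g (p t))
    rw [hg.2 _ (hpm s s.2) _ (hpm t t.2)] at h1
    have h2 := dist_triangle4 (k s) (f (g (p s))) (f (g (p t))) (k t)
    rw [dist_comm (f (g (p t))) (k t)] at h2
    have h3 : l * |p s - p t| ≤ l * |(s : ℝ) - t| := by 
      exact mul_le_mul_of_nonneg_left (hp _ _) (by linarith)
    rw [Subtype.dist_eq, Real.dist_eq]
    linarith [hk s, hk t]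
  · have h1 := hf.le_dist (g (p s)) (g (p t))
    rw [hg.2 _ (hpm s s.2) _ (hpm t t.2)] at h1
    have h2 := dist_triangle4 (f (g (p s))) (k s) (k t) (f (g (p t)))
    rw [dist_comm _ (k s)] at h2
    have h3 := hp' s s.2 t t.2
    rw [Subtype.dist_eq, Real.dist_eq]
    have h4 : dist (f (g (p s))) (f (g (p t))) + c ≤ dist (k s) (k t) + c + 2 * C := by
      linarith [hk s, hk t]
    have h5 : l * (dist (f (g (p s))) (f (g (p t))) + c) ≤ l * (dist (k s) (k t) + c + 2 * C) := by
      gcongr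
    nlinarith

/-! ### The three equivalent conditions. -/

theorem FourPoint.isQuasiruler {Y : Type u} [MetricSpace Y] {δ : ℝ} (hδ : 0 < δ)
    (h : FourPoint δ Y) (l c : ℝ) :
    ∃ T : ℝ, 0 ≤ T ∧ ∀ (I : Set ℝ) (g : ℝ → Y), IsQuasigeodesic l c I g → IsQuasiruler T I g := by
  obtain ⟨T, hT0, hT⟩ := h.exists_gromovProduct_le hδ l c
  refine ⟨T, hT0, fun I g hg => ⟨⟨l, c, hg⟩, fun s hs t _ u hu hst htu => ?_⟩⟩
  exact hT s u g (hg.mono (hst.le.trans htu.le) (hg.1.Icc_subset hs hu)) t ⟨hst.le, htu.le⟩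

theorem IsQuasiruler.gromovProduct_le {Y : Type u} [MetricSpace Y] {T a b : ℝ} {g : ℝ → Y}
    (h : IsQuasiruler T (Icc a b) g) {t : ℝ} (ht : t ∈ Icc a b) :
    gromovProduct (g a) (g b) (g t) ≤ max T 0 := by
  rcases ht.1.eq_or_lt with rfl | h1
  · refine le_max_of_le_right ?_
    simp [gromovProduct, dist_comm]
  rcases ht.2.eq_or_lt with rfl | h2
  · refine le_max_of_le_right ?_
    simp [gromovProduct]
  exact le_max_of_le_left
    (h.2 a ⟨le_rfl, ht.1.trans ht.2⟩ t ht b ⟨ht.1.trans ht.2, le_rfl⟩ h1 h2)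

theorem IsHyperbolic.isQuasiruled {X : Type u} {Y : Type v} [MetricSpace X] [MetricSpace Y]
    {f : X → Y} (hX : IsGeodesicSpace X) (hf : IsQuasiIsometry f) (hY : IsHyperbolic Y) :
    IsQuasiruled Y := by
  obtain ⟨δ, hδ, h⟩ := isHyperbolic_iff_fourPoint.1 hY
  obtain ⟨l, c, hl, hc, hq⟩ := hf.exists_isQuasigeodesicSpace hX
  obtain ⟨T, hT0, hT⟩ := h.isQuasiruler hδ l c
  refine ⟨l, c, T + 1, hl, hc, by linarith, hq, fun I g hg => ?_⟩
  obtain ⟨h1, h2⟩ := hT I g hg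
  exact ⟨h1, fun s hs t ht u hu hst htu => (h2 s hs t ht u hu hst htu).trans (by linarith)⟩

/-- The curve `f ∘ g` is a quasigeodesic, but perhaps not with the constants `L, c` for which `Y` is
ruled. So the images of `g s` and `g u` are joined by an `(L, c)`-quasigeodesic `k`; stability in
`X` applied to `ψ ∘ k` shows that `k` passes near `f (g t)`, and the bound for `k` transfers. -/
theorem IsQuasiruled.isRuling {X : Type u} {Y : Type v} [MetricSpace X] [MetricSpace Y]
    {f : X → Y} (hX : IsHyperbolic X) (hf : IsQuasiIsometry f) (hY : IsQuasiruled Y) :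
    IsRuling f := by
  obtain ⟨δ, hδ, h⟩ := isHyperbolic_iff_fourPoint.1 hX
  obtain ⟨L, c, T, hL, hc, -, hq, hr⟩ := hY
  obtain ⟨C, l, m, ψ, hC, hf, hψ, hψq⟩ := hf.exists_inverse
  have hl := hf.1
  have hm := hf.2.1
  obtain ⟨D, hD0, hD⟩ := h.exists_bound hδ (l * L) (l * c + l * (2 * C + m))
  refine ⟨⟨l, m, hf⟩, max T 0 + (l * (D + 3 * (l * (C + m)) + 2 * δ) + m + C), by positivity,
    fun a b g hg => ⟨⟨_, _, hg.isQuasigeodesic.comp hf⟩, fun s hs t ht u hu hst htu => ?_⟩⟩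
  obtain ⟨a', b', k, hab', hk, hka, hkb⟩ := hq (f (g s)) (f (g u))
  have hB : ∀ x, dist x (ψ (f x)) ≤ l * (C + m) := fun x => by
    refine (hf.le_dist _ _).trans ?_
    gcongr
    exact hψ (f x)
  generalize l * (C + m) = B at hB ⊢
  have hstu : dist (g s) (g t) + dist (g t) (g u) = dist (g s) (g u) := by
    rw [hg.2 s hs t ht, hg.2 t ht u hu, hg.2 s hs u hu, abs_of_neg (by linarith),
      abs_of_neg (by linarith), abs_of_neg (by linarith)]
    ring
  have hs' := hB (g s)
  have hu' := hB (g u)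
  have h1 := dist_triangle4 (ψ (f (g s))) (g s) (g u) (ψ (f (g u)))
  have h2 := dist_triangle4 (g s) (ψ (f (g s))) (ψ (f (g u))) (g u)
  rw [dist_comm _ (g s)] at h1
  rw [dist_comm _ (g u)] at h2
  obtain ⟨v, hv, hv1, hv2⟩ := hD a' b' (fun t => ψ (k t)) hab' (hk.comp hψq)
    (min (dist (g s) (g t)) (dist (ψ (k a')) (ψ (k b'))))
    ⟨le_min dist_nonneg dist_nonneg, min_le_right _ _⟩
  simp only [hka, hkb] at hv1 hv2
  have h3 := dist_triangle (g s) (ψ (f (g s))) (ψ (k v))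
  have h4 := dist_triangle (g u) (ψ (f (g u))) (ψ (k v))
  have hnear : dist (g t) (ψ (k v)) ≤ D + 3 * B + 2 * δ := by
    have h5 := h.dist_le_add (x := g s) (y := g u) (p := g t) (q := ψ (k v))
      (r := dist (g s) (g t)) (A := 0) (B := D + 3 * B) (by linarith)
      (by rw [dist_comm (g u)]; linarith) (by
        have := min_le_left (dist (g s) (g t)) (dist (ψ (f (g s))) (ψ (f (g u))))
        linarith [dist_nonneg.trans hs']) (by
        have h6 := dist_nonneg (x := g t) (y := g u)
        rcases min_choice (dist (g s) (g t)) (dist (ψ (f (g s))) (ψ (f (g u)))) with h7 | h7 <;>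
        · rw [h7] at hv2
          linarith [dist_nonneg.trans hs'])
    linarith
  have h5 := (hf.dist_le (g t) (ψ (k v)))
  have h6 := dist_triangle_right (f (g t)) (k v) (f (ψ (k v)))
  have h7 : l * dist (g t) (ψ (k v)) ≤ l * (D + 3 * B + 2 * δ) := by gcongr
  have h8 := (hr _ k hk).gromovProduct_le hv
  rw [hka, hkb] at h8
  have h9 := gromovProduct_le_add (f (g s)) (f (g s)) (f (g u)) (f (g u)) (f (g t)) (k v)
  simp only [dist_self] at h9
  linarith [hψ (k v)]

/-- Every geodesic triple of points `x, y, z` has a centre. -/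
theorem FourPoint.exists_center {X : Type u} [MetricSpace X] {δ : ℝ} (hδ : 0 < δ)
    (h : FourPoint δ X) (hX : IsGeodesicSpace X) (x y z : X) :
    ∃ p, gromovProduct x y p ≤ δ ∧ gromovProduct x z p ≤ δ ∧ gromovProduct y z p ≤ δ := by
  obtain ⟨a, b, g, hg, rfl, rfl⟩ := hX x y
  have hab := hg.2 a ⟨le_rfl, hg.1⟩ b ⟨hg.1, le_rfl⟩
  rw [abs_sub_comm, abs_of_nonneg (by linarith [hg.1])] at hab
  have h1 := dist_triangle (g a) (g b) z
  have h2 := dist_triangle_left (g a) (g b) z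
  have h3 := dist_triangle (g b) (g a) z
  rw [dist_comm z, dist_comm z] at h2
  rw [dist_comm (g b) (g a)] at h3
  -- The centre is the point of the segment at distance `(y|z)_x` from `x`, the branch point of the
  -- comparison tripod.
  have ht : a + gromovProduct (g b) z (g a) ∈ Icc a b := by
    simp only [gromovProduct]
    rw [dist_comm (g b) (g a), dist_comm z]
    constructor <;> linarith
  have h4 := hg.2 a ⟨le_rfl, hg.1⟩ _ ht
  have h5 := hg.2 b ⟨hg.1, le_rfl⟩ _ ht
  rw [abs_sub_comm, abs_of_nonneg (by linarith [ht.1])] at h4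
  rw [abs_of_nonneg (by linarith [ht.2])] at h5
  refine ⟨g (a + gromovProduct (g b) z (g a)), ?_⟩
  generalize hp : g (a + gromovProduct (g b) z (g a)) = p at *
  simp only [gromovProduct] at *
  rw [dist_comm (g b) (g a), dist_comm z] at h4 h5
  have h6 := h (g a) (g b) z p
  have h7 := dist_comm z p
  refine ⟨by linarith, ?_, ?_⟩ <;> grind

/-- Take a centre `p` of `x, y, z`. As `(x|y)_p ≤ δ`, hyperbolicity makes `(x|w)_p` or `(y|w)_p` at
most `2 * δ`, and the complementary pair is already controlled. -/
theorem FourPoint.exists_crossing {X : Type u} [MetricSpace X] {δ : ℝ} (hδ : 0 < δ)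
    (h : FourPoint δ X) (hX : IsGeodesicSpace X) (x y z w : X) :
    ∃ p, (gromovProduct x z p ≤ 2 * δ ∧ gromovProduct y w p ≤ 2 * δ) ∨
      (gromovProduct x w p ≤ 2 * δ ∧ gromovProduct y z p ≤ 2 * δ) := by
  obtain ⟨p, h1, h2, h3⟩ := h.exists_center hδ hX x y z
  refine ⟨p, ?_⟩
  have h4 := h x y w p
  simp only [gromovProduct] at *
  rw [dist_comm w p] at *
  grind

/-- A ruling map coarsely preserves the relation of being near a geodesic. -/
theorem IsRuling.exists_gromovProduct_le {X : Type u} {Y : Type v} [MetricSpace X] [MetricSpace Y]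
    {f : X → Y} {δ : ℝ} (h : FourPoint δ X) (hX : IsGeodesicSpace X) (hf : IsRuling f) (A : ℝ) :
    ∃ B : ℝ, ∀ x y p : X, gromovProduct x y p ≤ A → gromovProduct (f x) (f y) (f p) ≤ B := by
  obtain ⟨⟨l, c, hq⟩, T, hT, hr⟩ := hf
  have hl := hq.1
  refine ⟨max T 0 + (l * (A + 2 * δ) + c), fun x y p hp => ?_⟩
  obtain ⟨a, b, g, hg, rfl, rfl⟩ := hX x y
  have hab := hg.2 a ⟨le_rfl, hg.1⟩ b ⟨hg.1, le_rfl⟩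
  rw [abs_sub_comm, abs_of_nonneg (by linarith [hg.1])] at hab
  have h1 := dist_triangle (g a) (g b) p
  have h2 := dist_triangle_left (g a) (g b) p
  have h3 := dist_triangle (g b) (g a) p
  rw [dist_comm p, dist_comm p] at h2
  rw [dist_comm (g b) (g a)] at h3
  have ht : a + gromovProduct (g b) p (g a) ∈ Icc a b := by
    simp only [gromovProduct]
    rw [dist_comm (g b) (g a), dist_comm p]
    constructor <;> linarith
  have h4 := hg.2 a ⟨le_rfl, hg.1⟩ _ ht
  have h5 := hg.2 b ⟨hg.1, le_rfl⟩ _ ht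
  rw [abs_sub_comm, abs_of_nonneg (by linarith [ht.1])] at h4
  rw [abs_of_nonneg (by linarith [ht.2])] at h5
  have h8 := (hr a b g hg).gromovProduct_le ht
  generalize g (a + gromovProduct (g b) p (g a)) = q at *
  -- `q` is the point of the segment at distance `(y|p)_x` from `x`, a coarse projection of `p`.
  have h9 : dist p q ≤ A + 2 * δ := by
    have h6 := h (g a) (g b) p q
    simp only [gromovProduct] at *
    rw [dist_comm (g b) (g a), dist_comm p (g a)] at h4 h5
    grind
  have h10 := gromovProduct_le_add (f (g a)) (f (g a)) (f (g b)) (f (g b)) (f p) (f q)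
  simp only [dist_self] at h10
  have h11 := hq.dist_le p q
  have h12 : l * dist p q ≤ l * (A + 2 * δ) := by gcongr
  linarith

theorem fourPoint_of_dist_le {Y : Type u} {Z : Type v} [MetricSpace Y] [MetricSpace Z] {δ C : ℝ}
    (h : FourPoint δ Y) (ρ : Z → Y) (hρ : ∀ z z', |dist z z' - dist (ρ z) (ρ z')| ≤ C) :
    FourPoint (δ + 2 * C) Z := by
  intro a b c d
  have := h (ρ a) (ρ b) (ρ c) (ρ d)
  have h1 := abs_le.1 (hρ a b)
  have h2 := abs_le.1 (hρ c d)
  have h3 := abs_le.1 (hρ a c)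
  have h4 := abs_le.1 (hρ b d)
  have h5 := abs_le.1 (hρ a d)
  have h6 := abs_le.1 (hρ b c)
  grind

/-- A crossing point `p` of four points still has bounded products after applying `f`. One cross sum
is then nearly the sum of the four distances to `f p`, which dominates `dist (f x) (f y) + dist (f
z) (f w)`; coarse surjectivity extends this to `Y`. -/
theorem IsRuling.isHyperbolic {X : Type u} {Y : Type v} [MetricSpace X] [MetricSpace Y]
    {f : X → Y} (hX : IsGeodesicSpace X) (hXh : IsHyperbolic X) (hq : IsQuasiIsometry f)
    (hf : IsRuling f) : IsHyperbolic Y := by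
  obtain ⟨δ, hδ, h⟩ := isHyperbolic_iff_fourPoint.1 hXh
  obtain ⟨B, hB⟩ := hf.exists_gromovProduct_le h hX (2 * δ)
  obtain ⟨C, l, m, ψ, hC, -, hψ, -⟩ := hq.exists_inverse
  have key : ∀ x y z w, dist (f x) (f y) + dist (f z) (f w) ≤
      max (dist (f x) (f z) + dist (f y) (f w)) (dist (f x) (f w) + dist (f y) (f z)) +
        2 * (2 * B) := by
    intro x y z w
    obtain ⟨p, ⟨h1, h2⟩ | ⟨h1, h2⟩⟩ := h.exists_crossing hδ hX x y z w <;>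
    · have h3 := hB _ _ _ h1
      have h4 := hB _ _ _ h2
      have h5 := dist_triangle_right (f x) (f y) (f p)
      have h6 := dist_triangle_right (f z) (f w) (f p)
      simp only [gromovProduct] at h3 h4
      grind
  refine isHyperbolic_iff_fourPoint.2 ⟨max (2 * B + 2 * (2 * C)) 1, by positivity, ?_⟩
  intro a b c d
  have h0 := key (ψ a) (ψ b) (ψ c) (ψ d)
  have hρ : ∀ y y', |dist y y' - dist (f (ψ y)) (f (ψ y'))| ≤ 2 * C := fun y y' => by
    have := dist_dist_dist_le y y' (f (ψ y)) (f (ψ y'))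
    rw [Real.dist_eq] at this
    linarith [hψ y, hψ y']
  have h1 := abs_le.1 (hρ a b)
  have h2 := abs_le.1 (hρ c d)
  have h3 := abs_le.1 (hρ a c)
  have h4 := abs_le.1 (hρ b d)
  have h5 := abs_le.1 (hρ a d)
  have h6 := abs_le.1 (hρ b c)
  have h7 := le_max_left (2 * B + 2 * (2 * C)) 1
  generalize max (2 * B + 2 * (2 * C)) 1 = M at *
  grind

theorem tfae_isHyperbolic_isQuasiruled_isRuling {X : Type u} {Y : Type v} [MetricSpace X]
    [MetricSpace Y] {φ : X → Y} (hX : IsGeodesicSpace X) (hXh : IsHyperbolic X)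
    (hφ : IsQuasiIsometry φ) : List.TFAE [IsHyperbolic Y, IsQuasiruled Y, IsRuling φ] := by
  tfae_have 1 → 2 := fun h => h.isQuasiruled hX hφ
  tfae_have 2 → 3 := fun h => h.isRuling hXh hφ
  tfae_have 3 → 1 := fun h => h.isHyperbolic hX hXh hφ
  tfae_finish

/-! ### Extremal functions and the injective hull. -/

/-- The upper bounds on three consecutive pieces add up to `dist x y`, so the triangle inequality
forces equality on each. -/
theorem isGeodesicSpace_of_forall_exists {W : Type u} [MetricSpace W]
    (h : ∀ x y : W, ∃ g : ℝ → W, g 0 = x ∧ g 1 = y ∧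
      ∀ s ∈ Icc (0 : ℝ) 1, ∀ t ∈ Icc (0 : ℝ) 1, dist (g s) (g t) ≤ |s - t| * dist x y) :
    IsGeodesicSpace W := by
  intro x y
  obtain ⟨g, h0, h1, hg⟩ := h x y
  rcases eq_or_ne x y with rfl | hxy
  · refine ⟨0, 0, fun _ => x, ⟨le_rfl, fun s hs t ht => ?_⟩, rfl, rfl⟩
    rw [show s = 0 from le_antisymm hs.2 hs.1, show t = 0 from le_antisymm ht.2 ht.1]
    simp
  have hd : 0 < dist x y := dist_pos.2 hxy
  set d := dist x y
  have hmem : ∀ t ∈ Icc 0 d, t / d ∈ Icc (0 : ℝ) 1 := fun t ht =>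
    ⟨div_nonneg ht.1 hd.le, (div_le_one hd).2 ht.2⟩
  have hle : ∀ s ∈ Icc 0 d, ∀ t ∈ Icc 0 d, dist (g (s / d)) (g (t / d)) ≤ |s - t| := by
    intro s hs t ht
    refine (hg _ (hmem s hs) _ (hmem t ht)).trans_eq ?_
    rw [← sub_div, abs_div, abs_of_pos hd, div_mul_cancel₀ _ hd.ne']
  have key : ∀ s ∈ Icc 0 d, ∀ t ∈ Icc 0 d, s ≤ t → dist (g (s / d)) (g (t / d)) = t - s := by
    intro s hs t ht hst
    have m0 : (0 : ℝ) ∈ Icc 0 d := ⟨le_rfl, hd.le⟩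
    have md : d ∈ Icc 0 d := ⟨hd.le, le_rfl⟩
    have h2 := hle 0 m0 s hs
    have h3 := hle s hs t ht
    have h4 := hle t ht d md
    rw [zero_div, h0, abs_sub_comm, abs_of_nonneg (by linarith [hs.1])] at h2
    rw [abs_sub_comm, abs_of_nonneg (by linarith)] at h3
    rw [div_self hd.ne', h1, abs_sub_comm, abs_of_nonneg (by linarith [ht.2])] at h4
    have h5 := dist_triangle4 x (g (s / d)) (g (t / d)) y
    have h6 : dist x y = d := rfl
    linarith
  refine ⟨0, d, fun t => g (t / d), ⟨hd.le, fun s hs t ht => ?_⟩, by simpa using h0,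
    by simpa [div_self hd.ne'] using h1⟩
  rcases le_total s t with hst | hst
  · rw [key s hs t ht hst, abs_sub_comm, abs_of_nonneg (by linarith)]
  · rw [dist_comm, key t ht s hs hst, abs_of_nonneg (by linarith)]

/-- Functions that dominate the metric of `Y`, i.e. `d(x, y) ≤ f x + f y`. -/
def Dominates {Y : Type u} [MetricSpace Y] (f : Y → ℝ) : Prop :=
  ∀ x y, dist x y ≤ f x + f y

/-- Extremal functions: the points of the injective hull. -/
def IsExtremal {Y : Type u} [MetricSpace Y] (f : Y → ℝ) : Prop :=
  Dominates f ∧ ∀ x, ∀ ε > 0, ∃ y, f x + f y ≤ dist x y + ε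

theorem Dominates.nonneg {Y : Type u} [MetricSpace Y] {f : Y → ℝ} (hf : Dominates f) (x : Y) :
    0 ≤ f x := by
  have := hf x x
  rw [dist_self] at this
  linarith

/-- The conjugate `x ↦ sup_y (d(x, y) - f y)`. -/
noncomputable def conjugate {Y : Type u} [MetricSpace Y] (f : Y → ℝ) (x : Y) : ℝ :=
  ⨆ y, (dist x y - f y)

theorem Dominates.bddAbove {Y : Type u} [MetricSpace Y] {f : Y → ℝ} (hf : Dominates f) (x : Y) :
    BddAbove (range fun y => dist x y - f y) := by
  refine ⟨f x, ?_⟩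
  rintro _ ⟨y, rfl⟩
  linarith [hf x y]

theorem Dominates.le_conjugate {Y : Type u} [MetricSpace Y] {f : Y → ℝ} (hf : Dominates f)
    (x y : Y) : dist x y - f y ≤ conjugate f x :=
  le_ciSup (hf.bddAbove x) y

theorem Dominates.conjugate_le {Y : Type u} [MetricSpace Y] {f : Y → ℝ} (hf : Dominates f)
    (x : Y) : conjugate f x ≤ f x :=
  haveI : Nonempty Y := ⟨x⟩
  ciSup_le fun y => by linarith [hf x y]

/-- Conjugation reverses order (`r = 0`) and is 1-Lipschitz for the sup norm. -/
theorem conjugate_le_add {Y : Type u} [MetricSpace Y] {f g : Y → ℝ} {r : ℝ} (hg : Dominates g)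
    (h : ∀ x, g x ≤ f x + r) (x : Y) : conjugate f x ≤ conjugate g x + r :=
  haveI : Nonempty Y := ⟨x⟩
  ciSup_le fun y => by linarith [hg.le_conjugate x y, h y]

theorem exists_conjugate_lt {Y : Type u} [MetricSpace Y] (f : Y → ℝ) (x : Y) {ε : ℝ} (hε : 0 < ε) :
    ∃ y, conjugate f x - ε < dist x y - f y :=
  haveI : Nonempty Y := ⟨x⟩
  exists_lt_of_lt_ciSup (sub_lt_self _ hε)

/-- The average of a function with its conjugate. -/
noncomputable def average {Y : Type u} [MetricSpace Y] (f : Y → ℝ) (x : Y) : ℝ :=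
  (f x + conjugate f x) / 2

theorem Dominates.average {Y : Type u} [MetricSpace Y] {f : Y → ℝ} (hf : Dominates f) :
    Dominates (average f) := by
  intro x y
  have h1 := hf.le_conjugate x y
  have h2 := hf.le_conjugate y x
  rw [dist_comm y x] at h2
  simp only [QuasiRuled.average]
  linarith

theorem Dominates.iterate_average {Y : Type u} [MetricSpace Y] {f : Y → ℝ} (hf : Dominates f)
    (n : ℕ) : Dominates (QuasiRuled.average^[n] f) := by
  induction n with
  | zero => exact hf
  | succ n ih =>
    rw [Function.iterate_succ_apply']
    exact ih.average

theorem Dominates.average_le {Y : Type u} [MetricSpace Y] {f : Y → ℝ} (hf : Dominates f) (x : Y) :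
    QuasiRuled.average f x ≤ f x := by
  simp only [QuasiRuled.average]
  linarith [hf.conjugate_le x]

/-- Averaging halves the gap between a function and its conjugate; it also lowers the function, so
the new conjugate only rises. -/
theorem Dominates.iterate_average_sub_conjugate_le {Y : Type u} [MetricSpace Y] {f : Y → ℝ}
    (hf : Dominates f) (x : Y) (n : ℕ) :
    QuasiRuled.average^[n] f x - conjugate (QuasiRuled.average^[n] f) x ≤
      (f x - conjugate f x) / 2 ^ n := by
  induction n with
  | zero => simp
  | succ n ih =>
    have hn := hf.iterate_average n
    rw [Function.iterate_succ_apply', pow_succ, ← div_div]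
    generalize QuasiRuled.average^[n] f = h at *
    have h1 := conjugate_le_add (f := h) (g := QuasiRuled.average h) (r := 0) hn.average
      (fun y => by simpa using hn.average_le y) x
    have h2 : QuasiRuled.average h x = (h x + conjugate h x) / 2 := rfl
    linarith

theorem average_le_add {Y : Type u} [MetricSpace Y] {f g : Y → ℝ} {r : ℝ} (hf : Dominates f)
    (hg : Dominates g) (h : ∀ x, |f x - g x| ≤ r) (x : Y) : |average f x - average g x| ≤ r := by
  have h1 := conjugate_le_add hg (f := f) (r := r) (fun x => by linarith [(abs_le.1 (h x)).1]) x
  have h2 := conjugate_le_add hf (f := g) (r := r) (fun x => by linarith [(abs_le.1 (h x)).2]) x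
  have h3 := abs_le.1 (h x)
  simp only [average, abs_le]
  constructor <;> linarith

/-- The retraction onto extremal functions. -/
noncomputable def retract {Y : Type u} [MetricSpace Y] (f : Y → ℝ) (x : Y) : ℝ :=
  ⨅ n : ℕ, average^[n] f x

theorem Dominates.bddBelow {Y : Type u} [MetricSpace Y] {f : Y → ℝ} (hf : Dominates f) (x : Y) :
    BddBelow (range fun n : ℕ => QuasiRuled.average^[n] f x) := by
  refine ⟨0, ?_⟩
  rintro _ ⟨n, rfl⟩
  exact (hf.iterate_average n).nonneg x

theorem Dominates.retract_le {Y : Type u} [MetricSpace Y] {f : Y → ℝ} (hf : Dominates f) (x : Y)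
    (n : ℕ) : retract f x ≤ QuasiRuled.average^[n] f x :=
  ciInf_le (hf.bddBelow x) n

theorem Dominates.antitone_iterate {Y : Type u} [MetricSpace Y] {f : Y → ℝ} (hf : Dominates f)
    (x : Y) : Antitone fun n : ℕ => QuasiRuled.average^[n] f x := by
  refine antitone_nat_of_succ_le fun n => ?_
  simp only [Function.iterate_succ_apply']
  exact (hf.iterate_average n).average_le x

theorem Dominates.isExtremal_retract {Y : Type u} [MetricSpace Y] {f : Y → ℝ} (hf : Dominates f) :
    IsExtremal (retract f) := by
  constructor
  · intro x y
    refine le_of_forall_pos_le_add fun ε hε => ?_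
    obtain ⟨m, hm⟩ := exists_lt_of_ciInf_lt (lt_add_of_pos_right (retract f x) (half_pos hε))
    obtain ⟨n, hn⟩ := exists_lt_of_ciInf_lt (lt_add_of_pos_right (retract f y) (half_pos hε))
    have h1 := hf.iterate_average (max m n) x y
    have h2 := hf.antitone_iterate x (le_max_left m n)
    have h3 := hf.antitone_iterate y (le_max_right m n)
    simp only at h2 h3
    linarith
  · intro x ε hε
    obtain ⟨n, hn⟩ := exists_nat_gt ((f x - conjugate f x) / (ε / 2))
    have h1 : (f x - conjugate f x) / 2 ^ n ≤ ε / 2 := by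
      rw [div_lt_iff₀ (half_pos hε)] at hn
      rw [div_le_iff₀ (by positivity)]
      have : (n : ℝ) ≤ 2 ^ n := by exact_mod_cast Nat.lt_two_pow_self.le
      nlinarith
    obtain ⟨y, hy⟩ := exists_conjugate_lt (QuasiRuled.average^[n] f) x (half_pos hε)
    refine ⟨y, ?_⟩
    linarith [hf.iterate_average_sub_conjugate_le x n, hf.retract_le x n, hf.retract_le y n]

theorem abs_retract_sub_le {Y : Type u} [MetricSpace Y] {f g : Y → ℝ} {r : ℝ} (hf : Dominates f)
    (hg : Dominates g) (h : ∀ x, |f x - g x| ≤ r) (x : Y) : |retract f x - retract g x| ≤ r := by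
  have hn : ∀ n : ℕ, ∀ x, |average^[n] f x - average^[n] g x| ≤ r := by
    intro n
    induction n with
    | zero => exact h
    | succ n ih =>
      simp only [Function.iterate_succ_apply']
      exact average_le_add (hf.iterate_average n) (hg.iterate_average n) ih
  rw [abs_le]
  constructor
  · have : retract g x - r ≤ retract f x := le_ciInf fun n => by
      linarith [hg.retract_le x n, (abs_le.1 (hn n x)).1]
    linarith
  · have : retract f x - r ≤ retract g x := le_ciInf fun n => by
      linarith [hf.retract_le x n, (abs_le.1 (hn n x)).2]
    linarith

theorem IsExtremal.le_of_dominates {Y : Type u} [MetricSpace Y] {f g : Y → ℝ} (hf : IsExtremal f)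
    (hg : Dominates g) (h : ∀ x, g x ≤ f x) : g = f := by
  funext x
  refine le_antisymm (h x) (le_of_forall_pos_le_add fun ε hε => ?_)
  obtain ⟨y, hy⟩ := hf.2 x ε hε
  linarith [hg x y, h y]

theorem IsExtremal.retract_eq {Y : Type u} [MetricSpace Y] {f : Y → ℝ} (hf : IsExtremal f) :
    retract f = f :=
  hf.le_of_dominates hf.1.isExtremal_retract.1 fun x => hf.1.retract_le x 0

theorem IsExtremal.le_add_dist {Y : Type u} [MetricSpace Y] {f : Y → ℝ} (hf : IsExtremal f)
    (x y : Y) : f x ≤ f y + dist x y := by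
  refine le_of_forall_pos_le_add fun ε hε => ?_
  obtain ⟨z, hz⟩ := hf.2 x ε hε
  linarith [hf.1 y z, dist_triangle x y z]

/-- The injective hull of `Y`. -/
@[ext]
structure InjectiveHull (Y : Type u) [MetricSpace Y] : Type u where
  /-- The underlying function. -/
  toFun : Y → ℝ
  isExtremal : IsExtremal toFun

namespace InjectiveHull

variable {Y : Type u} [MetricSpace Y]

theorem bddAbove (f g : InjectiveHull Y) : BddAbove (range fun x => |f.1 x - g.1 x|) := by
  rcases isEmpty_or_nonempty Y with h | ⟨⟨y⟩⟩
  · simp [range_eq_empty]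
  · refine ⟨f.1 y + g.1 y, ?_⟩
    rintro _ ⟨x, rfl⟩
    simp only [abs_le]
    have h1 := f.2.le_add_dist x y
    have h2 := g.2.le_add_dist x y
    have h3 := f.2.1 x y
    have h4 := g.2.1 x y
    constructor <;> linarith

noncomputable instance : Dist (InjectiveHull Y) := ⟨fun f g => ⨆ x, |f.1 x - g.1 x|⟩

theorem abs_sub_le_dist (f g : InjectiveHull Y) (x : Y) : |f.1 x - g.1 x| ≤ dist f g :=
  le_ciSup (bddAbove f g) x

theorem dist_le {f g : InjectiveHull Y} {r : ℝ} (hr : 0 ≤ r) (h : ∀ x, |f.1 x - g.1 x| ≤ r) :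
    dist f g ≤ r :=
  Real.iSup_le h hr

theorem zero_le_dist (f g : InjectiveHull Y) : 0 ≤ dist f g :=
  Real.iSup_nonneg fun _ => abs_nonneg _

noncomputable instance : MetricSpace (InjectiveHull Y) where
  dist_self f := le_antisymm (dist_le le_rfl fun x => by simp) (zero_le_dist f f)
  dist_comm f g := by
    refine le_antisymm (dist_le (zero_le_dist g f) fun x => ?_)
      (dist_le (zero_le_dist f g) fun x => ?_) <;>
    · rw [abs_sub_comm]
      exact abs_sub_le_dist _ _ x
  dist_triangle f g h :=
    dist_le (add_nonneg (zero_le_dist f g) (zero_le_dist g h)) fun x =>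
      (abs_sub_le (f.1 x) (g.1 x) (h.1 x)).trans
        (add_le_add (abs_sub_le_dist f g x) (abs_sub_le_dist g h x))
  eq_of_dist_eq_zero {f g} h := by
    refine InjectiveHull.ext (funext fun x => ?_)
    have := abs_sub_le_dist f g x
    rw [h] at this
    exact sub_eq_zero.1 (abs_eq_zero.1 (le_antisymm this (abs_nonneg _)))

/-- Convex combinations of extremal functions dominate but need not be extremal. The retraction
fixes the endpoints and is 1-Lipschitz, so it carries the affine segment into the hull. -/
theorem exists_segment (f g : InjectiveHull Y) :
    ∃ k : ℝ → InjectiveHull Y, k 0 = f ∧ k 1 = g ∧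
      ∀ s ∈ Icc (0 : ℝ) 1, ∀ t ∈ Icc (0 : ℝ) 1, dist (k s) (k t) ≤ |s - t| * dist f g := by
  have hdom : ∀ t ∈ Icc (0 : ℝ) 1, Dominates (fun x => (1 - t) * f.1 x + t * g.1 x) := by
    intro t ht x y
    have h1 := f.2.1 x y
    have h2 := g.2.1 x y
    nlinarith [mul_le_mul_of_nonneg_left h1 (sub_nonneg.2 ht.2),
      mul_le_mul_of_nonneg_left h2 ht.1]
  classical
  refine ⟨fun t => if ht : t ∈ Icc (0 : ℝ) 1 then ⟨_, (hdom t ht).isExtremal_retract⟩ else f,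
    ?_, ?_, fun s hs t ht => ?_⟩
  · simp only [dif_pos (show (0 : ℝ) ∈ Icc (0 : ℝ) 1 by simp)]
    refine InjectiveHull.ext ?_
    simpa using f.2.retract_eq
  · simp only [dif_pos (show (1 : ℝ) ∈ Icc (0 : ℝ) 1 by simp)]
    refine InjectiveHull.ext ?_
    simpa using g.2.retract_eq
  · simp only [dif_pos hs, dif_pos ht]
    refine dist_le (by positivity) (abs_retract_sub_le (hdom s hs) (hdom t ht) fun x => ?_)
    have h1 : (1 - s) * f.1 x + s * g.1 x - ((1 - t) * f.1 x + t * g.1 x) =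
        -((s - t) * (f.1 x - g.1 x)) := by ring
    rw [h1, abs_neg, abs_mul]
    gcongr
    exact abs_sub_le_dist f g x

/-- The canonical embedding of `Y` in its injective hull. -/
def of (y : Y) : InjectiveHull Y :=
  ⟨dist y, fun x z => by linarith [dist_triangle_left x z y], fun x ε hε =>
    ⟨y, by rw [dist_self, dist_comm]; linarith⟩⟩

theorem dist_of (f : InjectiveHull Y) (y : Y) : dist f (of y) = f.1 y := by
  refine le_antisymm (dist_le (f.2.1.nonneg y) fun x => ?_) ?_
  · have h1 := f.2.le_add_dist x y
    have h2 := f.2.1 x y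
    simp only [of, abs_le]
    rw [dist_comm y x]
    constructor <;> linarith
  · have h1 := abs_sub_le_dist f (of y) y
    simp only [of, dist_self, sub_zero] at h1
    exact (le_abs_self _).trans h1

theorem dist_of_of (x y : Y) : dist (of x) (of y) = dist x y := dist_of _ _

/-- In the hull of a roughly geodesic hyperbolic space, every point is near `Y`. -/
theorem exists_dist_of_le {δ C : ℝ} (h : FourPoint δ Y)
    (hY : ∀ x y : Y, ∀ r ∈ Icc 0 (dist x y), ∃ z, dist x z ≤ r + C ∧ dist y z ≤ dist x y - r + C)
    [Nonempty Y] (f : InjectiveHull Y) : ∃ y, dist f (of y) ≤ 2 * δ + C + 3 := by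
  obtain ⟨x⟩ := ‹Nonempty Y›
  -- Since `f x + f x'` is nearly `dist x x'`, `f` lies almost between `x` and `x'`, and `y` is
  -- taken at the same parameter. A near-antipode `y'` of `y` and the four-point inequality then
  -- bound `f y`.
  obtain ⟨x', hx'⟩ := f.2.2 x 1 one_pos
  have h0 := f.2.1.nonneg x
  have h0' := f.2.1.nonneg x'
  obtain ⟨y, hy1, hy2⟩ := hY x x' (min (f.1 x) (dist x x'))
    ⟨le_min h0 dist_nonneg, min_le_right _ _⟩
  have h1 : dist x y ≤ f.1 x + C := by linarith [min_le_left (f.1 x) (dist x x')]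
  have h2 : dist x' y ≤ f.1 x' + C := by
    have := f.2.1 x x'
    rcases min_choice (f.1 x) (dist x x') with h3 | h3 <;> rw [h3] at hy2 <;> linarith
  refine ⟨y, ?_⟩
  rw [dist_of]
  obtain ⟨y', hy'⟩ := f.2.2 y 1 one_pos
  have h3 := h x x' y y'
  have h4 := f.2.1 x y'
  have h5 := f.2.1 x' y'
  grind

section Action

variable {Γ : Type w} [Group Γ] [MulAction Γ Y]

theorem _root_.QuasiRuled.IsExtremal.comp_smul [IsIsometricSMul Γ Y] {f : Y → ℝ}
    (hf : IsExtremal f) (γ : Γ) : IsExtremal fun y => f (γ • y) := by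
  refine ⟨fun x y => ?_, fun x ε hε => ?_⟩
  · rw [← dist_smul γ x y]
    exact hf.1 _ _
  · obtain ⟨y, hy⟩ := hf.2 (γ • x) ε hε
    refine ⟨γ⁻¹ • y, ?_⟩
    rw [← dist_smul γ]
    simpa only [smul_inv_smul] using hy

/-- The action on the hull induced by an isometric action. -/
@[reducible] def mulAction [IsIsometricSMul Γ Y] : MulAction Γ (InjectiveHull Y) where
  smul γ f := ⟨fun y => f.1 (γ⁻¹ • y), f.2.comp_smul γ⁻¹⟩
  one_smul f := InjectiveHull.ext (funext fun y => by
    change f.1 ((1 : Γ)⁻¹ • y) = f.1 y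
    rw [inv_one, one_smul])
  mul_smul γ γ' f := InjectiveHull.ext (funext fun y => by
    change f.1 ((γ * γ')⁻¹ • y) = f.1 (γ'⁻¹ • γ⁻¹ • y)
    rw [mul_inv_rev, mul_smul])

attribute [local instance] mulAction

theorem smul_of [IsIsometricSMul Γ Y] (γ : Γ) (y : Y) : γ • of y = of (γ • y) :=
  InjectiveHull.ext (funext fun x => by
    change dist y (γ⁻¹ • x) = dist (γ • y) x
    rw [← dist_smul γ, smul_inv_smul])

theorem isIsometricSMul [IsIsometricSMul Γ Y] : IsIsometricSMul Γ (InjectiveHull Y) := by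
  have key : ∀ (γ : Γ) (f g : InjectiveHull Y), dist (γ • f) (γ • g) ≤ dist f g :=
    fun γ f g => dist_le dist_nonneg fun x => abs_sub_le_dist f g (γ⁻¹ • x)
  refine ⟨fun γ => Isometry.of_dist_eq fun f g => le_antisymm (key γ f g) ?_⟩
  simpa using key γ⁻¹ (γ • f) (γ • g)

end Action

end InjectiveHull

/-! ### Proper discontinuity tested on pairs of points. -/

theorem properlyDiscontinuousSMul_of_finite {Γ : Type w} {W : Type u} [Group Γ] [MetricSpace W]
    [MulAction Γ W] [IsIsometricSMul Γ W]
    (h : ∀ x y : W, ∃ ε > 0, {γ : Γ | dist (γ • x) y < ε}.Finite) :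
    ProperlyDiscontinuousSMul Γ W := by
  refine ⟨fun {K L} hK hL => ?_⟩
  have key : {γ : Γ | ∃ p ∈ K ×ˢ L, γ • p.1 = p.2}.Finite := by
    refine (hK.prod hL).induction_on (p := fun s => {γ : Γ | ∃ p ∈ s, γ • p.1 = p.2}.Finite)
      (by simp) (fun s t hst ht => ht.subset ?_) (fun s t hs ht => (hs.union ht).subset ?_) ?_
    · rintro γ ⟨p, hp, hγ⟩
      exact ⟨p, hst hp, hγ⟩
    · rintro γ ⟨p, hp | hp, hγ⟩
      · exact .inl ⟨p, hp, hγ⟩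
      · exact .inr ⟨p, hp, hγ⟩
    · rintro ⟨x, y⟩ -
      obtain ⟨ε, hε, hfin⟩ := h x y
      refine ⟨Metric.ball x (ε / 2) ×ˢ Metric.ball y (ε / 2), mem_nhdsWithin_of_mem_nhds
        (prod_mem_nhds (Metric.ball_mem_nhds _ (half_pos hε))
          (Metric.ball_mem_nhds _ (half_pos hε))), hfin.subset ?_⟩
      rintro γ ⟨⟨x', y'⟩, ⟨hx, hy⟩, hγ⟩
      simp only [Metric.mem_ball] at hx hy hγ
      have h1 := dist_triangle (γ • x) (γ • x') y
      rw [dist_smul, hγ, dist_comm x x'] at h1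
      simp only [mem_ofPred_eq]
      linarith
  refine key.subset ?_
  rintro γ ⟨_, ⟨x, hx, rfl⟩, hy⟩
  exact ⟨(x, γ • x), ⟨hx, hy⟩, rfl⟩

/-- Otherwise distinct `γ_n` satisfy `γ_n • x → y`, and all of them move `{x}` to meet the compact
set formed by the sequence and its limit. Increasing second components in `f` force the convergence.
-/
theorem exists_finite_dist_smul_lt {Γ : Type w} {W : Type u} [Group Γ] [MetricSpace W]
    [MulAction Γ W] [ProperlyDiscontinuousSMul Γ W] (x y : W) :
    ∃ ε > 0, {γ : Γ | dist (γ • x) y < ε}.Finite := by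
  by_contra! hcon
  obtain ⟨f, hf, hr⟩ := exists_seq_of_forall_finset_exists
    (fun p : Γ × ℕ => dist (p.1 • x) y < 1 / ((p.2 : ℝ) + 1))
    (fun p q => p.1 ≠ q.1 ∧ p.2 < q.2) (fun s _ => by
      classical
      have h1 := hcon (1 / (((s.sup Prod.snd + 1 : ℕ) : ℝ) + 1)) (by positivity)
      obtain ⟨γ, hγ, hs⟩ := Set.Infinite.exists_notMem_finset h1 (s.image Prod.fst)
      refine ⟨(γ, s.sup Prod.snd + 1), hγ, fun p hp => ⟨?_, ?_⟩⟩
      · rintro rfl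
        exact hs (Finset.mem_image_of_mem _ hp)
      · exact Nat.lt_succ_of_le (Finset.le_sup (f := Prod.snd) hp))
  have hinj : Function.Injective fun n => (f n).1 := by
    intro m n hmn
    rcases lt_trichotomy m n with h | h | h
    · exact absurd hmn (hr m n h).1
    · exact h
    · exact absurd hmn.symm (hr n m h).1
  have hmono : StrictMono fun n => (f n).2 := fun m n h => (hr m n h).2
  have hlim : Tendsto (fun n => (f n).1 • x) atTop (𝓝 y) := by
    rw [tendsto_iff_dist_tendsto_zero]
    exact squeeze_zero (fun _ => dist_nonneg) (fun n => (hf n).le)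
      (tendsto_one_div_add_atTop_nhds_zero_nat.comp hmono.tendsto_atTop)
  have hfin := ProperlyDiscontinuousSMul.finite_disjoint_inter_image (Γ := Γ)
    (isCompact_singleton (x := x)) hlim.isCompact_insert_range
  refine (Set.infinite_range_of_injective hinj) (hfin.subset ?_)
  rintro _ ⟨n, rfl⟩
  exact ⟨(f n).1 • x, ⟨x, rfl, rfl⟩, .inr ⟨n, rfl⟩⟩

/-! ### The hull of bumps. -/

/-- The family of bumps of all radii `1 / (k + 1)` centred at `y`. -/
noncomputable def bump {Y : Type u} [MetricSpace Y] (y : Y) : Y × ℕ →ᵇ ℝ :=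
  BoundedContinuousFunction.ofNormedAddCommGroup
    (fun p : Y × ℕ => max 0 (1 / ((p.2 : ℝ) + 1) - dist y p.1))
    (by
      have : Continuous fun n : ℕ => 1 / ((n : ℝ) + 1) := continuous_of_discreteTopology
      have h2 := this.comp (continuous_snd (X := Y))
      simp only [Function.comp_def] at h2
      fun_prop) 1
    (fun p => by
      have h1 : 1 / ((p.2 : ℝ) + 1) ≤ 1 := by
        rw [div_le_one (by positivity)]
        linarith [(Nat.cast_nonneg p.2 : (0 : ℝ) ≤ p.2)]
      rw [Real.norm_eq_abs, abs_of_nonneg (le_max_left _ _)]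
      exact max_le zero_le_one (by linarith [dist_nonneg (x := y) (y := p.1)]))

theorem bump_apply {Y : Type u} [MetricSpace Y] (y z : Y) (k : ℕ) :
    bump y (z, k) = max 0 (1 / ((k : ℝ) + 1) - dist y z) := rfl

theorem dist_bump_le {Y : Type u} [MetricSpace Y] (x y : Y) :
    dist (bump x) (bump y) ≤ dist x y := by
  refine (BoundedContinuousFunction.dist_le dist_nonneg).2 fun ⟨z, k⟩ => ?_
  rw [bump_apply, bump_apply, Real.dist_eq]
  have h1 := dist_triangle_left x z y
  have h2 := dist_triangle x y z
  have h3 := dist_triangle_left y z x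
  have h4 := dist_triangle y x z
  rw [dist_comm y x] at h4
  grind

/-- The convex hull of the bumps: a bounded geodesic space on which proper discontinuity of an
action on `Y` can be read off. -/
def BumpHull (Y : Type u) [MetricSpace Y] : Type u :=
  {h : Y × ℕ →ᵇ ℝ // h ∈ convexHull ℝ (range (bump (Y := Y)))}

namespace BumpHull

variable {Y : Type u} [MetricSpace Y]

noncomputable instance : MetricSpace (BumpHull Y) :=
  inferInstanceAs (MetricSpace {h : Y × ℕ →ᵇ ℝ // h ∈ convexHull ℝ (range (bump (Y := Y)))})

/-- The bump at `y` as a point of the hull. -/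
noncomputable def of (y : Y) : BumpHull Y := ⟨bump y, subset_convexHull _ _ ⟨y, rfl⟩⟩

theorem dist_of_of_le (x y : Y) : dist (of x) (of y) ≤ dist x y := dist_bump_le x y

theorem exists_segment (f g : BumpHull Y) :
    ∃ k : ℝ → BumpHull Y, k 0 = f ∧ k 1 = g ∧
      ∀ s ∈ Icc (0 : ℝ) 1, ∀ t ∈ Icc (0 : ℝ) 1, dist (k s) (k t) ≤ |s - t| * dist f g := by
  classical
  have hmem : ∀ t ∈ Icc (0 : ℝ) 1, AffineMap.lineMap f.1 g.1 t ∈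
      convexHull ℝ (range (bump (Y := Y))) := fun t ht =>
    (convex_convexHull ℝ _).lineMap_mem f.2 g.2 ht
  let k : ℝ → BumpHull Y := fun t =>
    if ht : t ∈ Icc (0 : ℝ) 1 then ⟨AffineMap.lineMap f.1 g.1 t, hmem t ht⟩ else f
  have hk : ∀ t ∈ Icc (0 : ℝ) 1, (k t).1 = AffineMap.lineMap f.1 g.1 t := fun t ht =>
    congrArg Subtype.val (dif_pos ht)
  refine ⟨k, ?_, ?_, fun s hs t ht => ?_⟩
  · exact Subtype.ext ((hk 0 (by simp)).trans (AffineMap.lineMap_apply_zero _ _))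
  · exact Subtype.ext ((hk 1 (by simp)).trans (AffineMap.lineMap_apply_one _ _))
  · change dist (k s).1 (k t).1 ≤ |s - t| * dist f.1 g.1
    rw [hk s hs, hk t ht, dist_lineMap_lineMap, Real.dist_eq]

theorem mem_Icc (f : BumpHull Y) (p : Y × ℕ) : f.1 p ∈ Icc (0 : ℝ) 1 := by
  have hconv : Convex ℝ {h : Y × ℕ →ᵇ ℝ | h p ∈ Icc (0 : ℝ) 1} := by
    intro h hh h' hh' a b ha hb hab
    simp only [mem_ofPred_eq, BoundedContinuousFunction.coe_add, Pi.add_apply,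
      BoundedContinuousFunction.coe_smul]
    exact convex_Icc (0 : ℝ) 1 hh hh' ha hb hab
  refine convexHull_min ?_ hconv f.2
  rintro _ ⟨y, rfl⟩
  refine ⟨le_max_left _ _, max_le zero_le_one ?_⟩
  have h1 : 1 / ((p.2 : ℝ) + 1) ≤ 1 := by
    rw [div_le_one (by positivity)]
    linarith [(Nat.cast_nonneg p.2 : (0 : ℝ) ≤ p.2)]
  linarith [dist_nonneg (x := y) (y := p.1)]

theorem dist_le_one (f g : BumpHull Y) : dist f g ≤ 1 := by
  refine (BoundedContinuousFunction.dist_le zero_le_one).2 fun p => ?_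
  have h1 := f.mem_Icc p
  have h2 := g.mem_Icc p
  rw [Real.dist_eq, abs_le]
  constructor <;> linarith [h1.1, h1.2, h2.1, h2.2]

/-- A peak of one summand survives in a convex combination, scaled by its weight, because the other
summand is nonnegative. -/
theorem exists_pos_le (f : BumpHull Y) :
    ∃ a > 0, ∃ y : Y, ∀ k : ℕ, a / ((k : ℝ) + 1) ≤ f.1 (y, k) := by
  have hconv : Convex ℝ {h : Y × ℕ →ᵇ ℝ | (∀ p, 0 ≤ h p) ∧
      ∃ a > 0, ∃ y : Y, ∀ k : ℕ, a / ((k : ℝ) + 1) ≤ h (y, k)} := by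
    rintro h ⟨hh, a, ha, y, hy⟩ h' ⟨hh', a', ha', y', hy'⟩ s t hs ht hst
    refine ⟨fun p => ?_, ?_⟩
    · simp only [BoundedContinuousFunction.coe_add, Pi.add_apply,
        BoundedContinuousFunction.coe_smul, smul_eq_mul]
      have := hh p
      have := hh' p
      positivity
    · simp only [BoundedContinuousFunction.coe_add, Pi.add_apply,
        BoundedContinuousFunction.coe_smul, smul_eq_mul]
      rcases hs.eq_or_lt with rfl | hs
      · rw [zero_add] at hst
        subst hst
        exact ⟨a', ha', y', by simpa using hy'⟩
      · refine ⟨s * a, by positivity, y, fun k => ?_⟩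
        rw [mul_div_assoc]
        have h1 := mul_le_mul_of_nonneg_left (hy k) hs.le
        have h2 := mul_nonneg ht (hh' (y, k))
        linarith
  refine (convexHull_min ?_ hconv f.2).2
  rintro _ ⟨y, rfl⟩
  refine ⟨fun p => le_max_left _ _, 1, one_pos, y, fun k => ?_⟩
  rw [bump_apply, dist_self, sub_zero]
  exact le_max_right _ _

theorem exists_finite_support (f : BumpHull Y) :
    ∃ S : Set Y, S.Finite ∧ ∀ (z : Y) (k : ℕ), 0 < f.1 (z, k) →
      ∃ y ∈ S, dist z y < 1 / ((k : ℝ) + 1) := by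
  have hconv : Convex ℝ {h : Y × ℕ →ᵇ ℝ | ∃ S : Set Y, S.Finite ∧ ∀ (z : Y) (k : ℕ),
      0 < h (z, k) → ∃ y ∈ S, dist z y < 1 / ((k : ℝ) + 1)} := by
    rintro h ⟨S, hS, h1⟩ h' ⟨S', hS', h1'⟩ s t hs ht hst
    refine ⟨S ∪ S', hS.union hS', fun z k hz => ?_⟩
    simp only [BoundedContinuousFunction.coe_add, Pi.add_apply,
      BoundedContinuousFunction.coe_smul, smul_eq_mul] at hz
    rcases lt_or_ge 0 (h (z, k)) with h2 | h2
    · obtain ⟨y, hy, hyz⟩ := h1 z k h2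
      exact ⟨y, .inl hy, hyz⟩
    · rcases lt_or_ge 0 (h' (z, k)) with h2' | h2'
      · obtain ⟨y, hy, hyz⟩ := h1' z k h2'
        exact ⟨y, .inr hy, hyz⟩
      · linarith [mul_nonpos_of_nonneg_of_nonpos hs h2, mul_nonpos_of_nonneg_of_nonpos ht h2']
  refine convexHull_min ?_ hconv f.2
  rintro _ ⟨y, rfl⟩
  refine ⟨{y}, finite_singleton y, fun z k hz => ⟨y, rfl, ?_⟩⟩
  rw [bump_apply, lt_max_iff] at hz
  rw [dist_comm]
  rcases hz with hz | hz
  · exact absurd hz (lt_irrefl _)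
  · linarith

section Action

variable {Γ : Type w} [Group Γ] [MulAction Γ Y] [IsIsometricSMul Γ Y]

/-- Translation of bounded continuous functions on `Y × ℕ`. -/
noncomputable def translate (γ : Γ) : (Y × ℕ →ᵇ ℝ) →ₗ[ℝ] (Y × ℕ →ᵇ ℝ) where
  toFun f := f.compContinuous ⟨fun p => (γ⁻¹ • p.1, p.2), by
    have := (isometry_smul Y γ⁻¹).continuous
    fun_prop⟩
  map_add' _ _ := rfl
  map_smul' _ _ := rfl

theorem translate_apply (γ : Γ) (f : Y × ℕ →ᵇ ℝ) (z : Y) (k : ℕ) :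
    translate γ f (z, k) = f (γ⁻¹ • z, k) := rfl

theorem translate_bump (γ : Γ) (y : Y) : translate γ (bump y) = bump (γ • y) := by
  ext ⟨z, k⟩
  rw [translate_apply, bump_apply, bump_apply, ← dist_smul γ, smul_inv_smul]

theorem translate_mem (γ : Γ) {f : Y × ℕ →ᵇ ℝ} (hf : f ∈ convexHull ℝ (range (bump (Y := Y)))) :
    translate γ f ∈ convexHull ℝ (range (bump (Y := Y))) := by
  have h1 : translate γ f ∈ translate γ '' convexHull ℝ (range (bump (Y := Y))) := ⟨f, hf, rfl⟩
  rw [LinearMap.image_convexHull] at h1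
  refine convexHull_mono ?_ h1
  rintro _ ⟨_, ⟨y, rfl⟩, rfl⟩
  exact ⟨γ • y, (translate_bump γ y).symm⟩

/-- The action on the hull of the bumps induced by an isometric action. -/
@[reducible] noncomputable def mulAction : MulAction Γ (BumpHull Y) where
  smul γ f := ⟨translate γ f.1, translate_mem γ f.2⟩
  one_smul f := Subtype.ext <| by
    change translate (1 : Γ) f.1 = f.1
    ext ⟨z, k⟩
    rw [translate_apply, inv_one, one_smul]
  mul_smul γ γ' f := Subtype.ext <| by
    change translate (γ * γ') f.1 = translate γ (translate γ' f.1)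
    ext ⟨z, k⟩
    rw [translate_apply, translate_apply, translate_apply, mul_inv_rev, mul_smul]

attribute [local instance] mulAction

theorem smul_of (γ : Γ) (y : Y) : γ • of y = of (γ • y) :=
  Subtype.ext (translate_bump γ y)

theorem isIsometricSMul : IsIsometricSMul Γ (BumpHull Y) := by
  have key : ∀ (γ : Γ) (f g : BumpHull Y), dist (γ • f) (γ • g) ≤ dist f g := fun γ f g =>
    (BoundedContinuousFunction.dist_le dist_nonneg).2 fun ⟨z, k⟩ =>
      BoundedContinuousFunction.dist_coe_le_dist (f := f.1) (g := g.1) (γ⁻¹ • z, k)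
  refine ⟨fun γ => Isometry.of_dist_eq fun f g => le_antisymm (key γ f g) ?_⟩
  simpa using key γ⁻¹ (γ • f) (γ • g)

/-- If `γ • f` is close to `g`, the peak of `f` at `y`, moved to `γ • y`, must lie in the support of
`g` at scale `k`, hence near one of finitely many points. All radii are kept in `bump` because `k`
depends on how small the radii `ε y'` are. -/
theorem exists_finite_dist_smul_lt [ProperlyDiscontinuousSMul Γ Y] (f g : BumpHull Y) :
    ∃ ε > 0, {γ : Γ | dist (γ • f) g < ε}.Finite := by
  obtain ⟨a, ha, y, hy⟩ := f.exists_pos_le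
  obtain ⟨S, hS, hg⟩ := g.exists_finite_support
  choose ε hε hfin using fun y' : Y => QuasiRuled.exists_finite_dist_smul_lt (Γ := Γ) y y'
  obtain ⟨k, hk⟩ : ∃ k : ℕ, ∀ y' ∈ S, 1 / ((k : ℝ) + 1) < ε y' := by
    have : ∀ᶠ k : ℕ in atTop, ∀ y' ∈ S, 1 / ((k : ℝ) + 1) < ε y' :=
      (Set.Finite.eventually_all hS).2 fun y' _ =>
        tendsto_one_div_add_atTop_nhds_zero_nat.eventually (gt_mem_nhds (hε y'))
    exact this.exists
  refine ⟨a / ((k : ℝ) + 1), by positivity, (hS.biUnion fun y' _ => hfin y').subset ?_⟩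
  intro γ hγ
  have h1 := (BoundedContinuousFunction.dist_coe_le_dist (f := (γ • f).1) (g := g.1)
    (γ • y, k)).trans_lt hγ
  have h2 : (γ • f).1 (γ • y, k) = f.1 (y, k) := by
    change translate γ f.1 (γ • y, k) = f.1 (y, k)
    rw [translate_apply, inv_smul_smul]
  rw [h2, Real.dist_eq] at h1
  have h3 : 0 < g.1 (γ • y, k) := by linarith [hy k, (abs_lt.1 h1).2]
  obtain ⟨y', hy', h4⟩ := hg _ _ h3
  exact mem_biUnion hy' (h4.trans (hk y' hy'))

end Action

end BumpHull

-- The product hull.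

attribute [local instance] InjectiveHull.mulAction BumpHull.mulAction

theorem exists_geodesic_hull (Y : Type v) [MetricSpace Y] (hY : IsHyperbolic Y)
    (hq : ∃ l c, IsQuasigeodesicSpace l c Y) :
    ∃ (Z : Type v) (_ : MetricSpace Z) (ι : Y → Z),
      IsGeodesicSpace Z ∧ IsHyperbolic Z ∧ Isometry ι ∧ IsQuasiconvex (range ι) ∧
      ∀ (Γ : Type w) [Group Γ] [MulAction Γ Y], IsIsometricSMul Γ Y →
        ∃ _ : MulAction Γ Z, IsIsometricSMul Γ Z ∧ (∀ (γ : Γ) (y : Y), ι (γ • y) = γ • ι y) ∧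
          (IsGeometricAction Γ Y → IsQuasiconvexGroupAction Γ Z) := by
  obtain ⟨δ, hδ, h⟩ := isHyperbolic_iff_fourPoint.1 hY
  obtain ⟨l, c, hq⟩ := hq
  obtain ⟨D, hD0, hD⟩ := h.exists_bound hδ l c
  have hrough : ∀ x y : Y, ∀ r ∈ Icc 0 (dist x y),
      ∃ z, dist x z ≤ r + D ∧ dist y z ≤ dist x y - r + D := by
    intro x y r hr
    obtain ⟨a, b, g, hab, hg, rfl, rfl⟩ := hq x y
    obtain ⟨t, -, ht⟩ := hD a b g hab hg r hr
    exact ⟨g t, ht⟩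
  let ι : Y → InjectiveHull Y × BumpHull Y := fun y => (.of y, .of y)
  have hι : Isometry ι := Isometry.of_dist_eq fun x y => by
    rw [Prod.dist_eq, InjectiveHull.dist_of_of]
    exact max_eq_left (BumpHull.dist_of_of_le x y)
  obtain ⟨R, hR⟩ : ∃ R : ℝ, ∀ z : InjectiveHull Y × BumpHull Y, ∃ y, dist z (ι y) ≤ R := by
    refine ⟨max (2 * δ + D + 3) 1, fun z => ?_⟩
    -- For empty `Y` the injective hull still has one point, but `BumpHull Y` is empty.
    have : Nonempty Y := by
      obtain ⟨-, -, y, -⟩ := z.2.exists_pos_le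
      exact ⟨y⟩
    obtain ⟨y, hy⟩ := InjectiveHull.exists_dist_of_le h hrough z.1
    exact ⟨y, max_le_max hy (BumpHull.dist_le_one _ _)⟩
  refine ⟨InjectiveHull Y × BumpHull Y, inferInstance, ι, ?_, ?_, hι, ?_, ?_⟩
  · refine isGeodesicSpace_of_forall_exists fun x y => ?_
    obtain ⟨g, h0, h1, hg⟩ := InjectiveHull.exists_segment x.1 y.1
    obtain ⟨k, k0, k1, hk⟩ := BumpHull.exists_segment x.2 y.2
    refine ⟨fun t => (g t, k t), Prod.ext h0 k0, Prod.ext h1 k1, fun s hs t ht => ?_⟩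
    rw [Prod.dist_eq, Prod.dist_eq, mul_max_of_nonneg _ _ (abs_nonneg _)]
    exact max_le_max (hg s hs t ht) (hk s hs t ht)
  · choose ρ hρ using hR
    have hbd : ∀ z z', |dist z z' - dist (ρ z) (ρ z')| ≤ 2 * R := fun z z' => by
      have := dist_dist_dist_le z z' (ι (ρ z)) (ι (ρ z'))
      rw [Real.dist_eq, hι.dist_eq] at this
      linarith [hρ z, hρ z']
    refine isHyperbolic_iff_fourPoint.2 ⟨max (δ + 2 * (2 * R)) 1, by positivity, ?_⟩
    intro a b c d
    have := fourPoint_of_dist_le h ρ hbd a b c d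
    linarith [le_max_left (δ + 2 * (2 * R)) 1]
  · refine ⟨R, fun a b g _ _ _ t _ => ?_⟩
    obtain ⟨y, hy⟩ := hR (g t)
    exact ⟨ι y, ⟨y, rfl⟩, hy⟩
  · intro Γ _ _ hΓ
    have := InjectiveHull.isIsometricSMul (Γ := Γ) (Y := Y)
    have := BumpHull.isIsometricSMul (Γ := Γ) (Y := Y)
    have hZ : IsIsometricSMul Γ (InjectiveHull Y × BumpHull Y) := inferInstance
    have heq : ∀ (γ : Γ) (y : Y), ι (γ • y) = γ • ι y := fun γ y =>
      Prod.ext (InjectiveHull.smul_of γ y).symm (BumpHull.smul_of γ y).symm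
    refine ⟨inferInstance, hZ, heq, ?_⟩
    rintro ⟨-, hpd, K, hK, hcov⟩
    refine ⟨hZ, properlyDiscontinuousSMul_of_finite fun x y => ?_, fun z₀ => ?_⟩
    · obtain ⟨ε, hε, hfin⟩ := BumpHull.exists_finite_dist_smul_lt (Γ := Γ) x.2 y.2
      exact ⟨ε, hε, hfin.subset fun γ hγ =>
        (le_max_right (dist (γ • x.1) y.1) (dist (γ • x.2) y.2)).trans_lt hγ⟩
    -- By cocompactness every orbit is coarsely dense in `Z`, hence quasiconvex.
    · obtain ⟨B, hB⟩ := (hK.image hι.continuous).isBounded.subset_closedBall z₀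
      refine ⟨R + B, fun a b g _ _ _ t _ => ?_⟩
      obtain ⟨y, hy⟩ := hR (g t)
      obtain ⟨γ, k, hk, rfl⟩ := hcov y
      refine ⟨γ • z₀, ⟨γ, rfl⟩, ?_⟩
      have h1 : dist (ι k) z₀ ≤ B := hB ⟨k, hk, rfl⟩
      have h2 := dist_triangle (g t) (ι (γ • k)) (γ • z₀)
      rw [heq, dist_smul] at h2
      rw [heq] at hy
      linarith

end QuasiRuled

theorem theorem1p9 :
    (∀ (X : Type u) (Y : Type v) [MetricSpace X] [MetricSpace Y] (φ : X → Y),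
      QuasiRuled.IsGeodesicSpace X → QuasiRuled.IsHyperbolic X → QuasiRuled.IsQuasiIsometry φ →
        List.TFAE [QuasiRuled.IsHyperbolic Y, QuasiRuled.IsQuasiruled Y, QuasiRuled.IsRuling φ]) ∧
    (∀ (Y : Type v) [MetricSpace Y],
      QuasiRuled.IsHyperbolic Y → QuasiRuled.IsQuasiruled Y →
        ∃ (Z : Type v) (_ : MetricSpace Z) (ι : Y → Z),
          QuasiRuled.IsGeodesicSpace Z ∧ QuasiRuled.IsHyperbolic Z ∧
          Isometry ι ∧ QuasiRuled.IsQuasiconvex (Set.range ι) ∧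
          ∀ (Γ : Type w) [Group Γ] [MulAction Γ Y], IsIsometricSMul Γ Y →
            ∃ _ : MulAction Γ Z, IsIsometricSMul Γ Z ∧
              (∀ (γ : Γ) (y : Y), ι (γ • y) = γ • ι y) ∧
              (QuasiRuled.IsGeometricAction Γ Y → QuasiRuled.IsQuasiconvexGroupAction Γ Z)) := by
  refine ⟨fun X Y _ _ φ hX hXh hφ =>
    QuasiRuled.tfae_isHyperbolic_isQuasiruled_isRuling hX hXh hφ, fun Y _ hY hq => ?_⟩
  obtain ⟨l, c, -, -, -, -, hq, -⟩ := hq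
  exact QuasiRuled.exists_geodesic_hull Y hY ⟨l, c, hq⟩
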